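/- Let $0<a_1<a_2<a_3$ and $c\in(a_1,a_3)\setminus\{a_2\}$ be real numbers, and let $$\Gamma:\ \mu^2=-\lambda(\lambda-c)(\lambda-a_1)(\lambda-a_2)(\lambda-a_3)=-\lambda\prod_{k=1}^4(\lambda-b_k),\qquad 0<b_1<b_2<b_3<b_4,$$ be the genus two curve associated to the geodesics on the triaxial ellipsoid $X_1^2/a_1+X_2^2/a_2+X_3^2/a_3=1$ with caustic parameter $c$. Put $\omega_1=d\lambda/\mu$, $\omega_2=\lambda\,d\lambda/\mu$, $P_0=(0,0)\in\Gamma$, and let $\alpha_1,\alpha_2$ be the real cycles around $[b_1,b_2]$ and $[b_3,b_4]$, oriented so that $\oint_{\alpha_i}\omega_j=2\int_{b_{2i-1}}^{b_{2i}}\lambda^{j-1}\,d\lambda\big/\sqrt{-\lambda\prod_k(\lambda-b_k)}>0$. The period mapping is $$\varphi(c)=\frac{2\oint_{\alpha_2}\omega_2}{2\oint_{\alpha_1}\omega_2}\ \text{ if } a_1<c<a_2,\qquad \varphi(c)=\frac{2\oint_{\alpha_1}\omega_2}{2\oint_{\alpha_2}\omega_2}\ \text{ if } a_2<c<a_3 .$$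 Assume that $(\Gamma,P_0)$ is a $3:1$ hyperelliptic tangential cover, i.e. there is a covering $\pi:\Gamma\to\mathcal E$ of degree $3$ onto an elliptic curve $\mathcal E:\ W^2=4Z^3-g_2Z-g_3$ which sends $P_0$ to the infinite point $Q_0$ of $\mathcal E$ and is such that the canonical map $\mathcal E\to\mathrm{Jac}(\Gamma)$, $Q\mapsto\pi^*(Q-Q_0)$, and the Abel map $\Gamma\to\mathrm{Jac}(\Gamma)$, $P\mapsto\int_{P_0}^P(\omega_1,\omega_2)$, have images tangent at the origin. Then the geodesics with parameter $c$ are closed, in the sense that there are integers $(m_1,m_2)\ne(0,0)$ and $T>0$ with $m_1\oint_{\alpha_1}\omega_1+m_2\oint_{\alpha_2}\omega_1=T$ and $m_1\oint_{\alpha_1}\omega_2+m_2\oint_{\alpha_2}\omega_2=0$, and their period mapping is $2:1$ or $1:2$: precisely, $\varphi(c)=2$ if $a_1<c<a_2$, and $\varphi(c)=1/2$ if $a_2<c<a_3$. -/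

import Mathlib

open Polynomial

namespace GeodesicCurve

noncomputable section

/-! ### The genus two curve `Γ : μ² = -λ (λ - b₁) (λ - b₂) (λ - b₃) (λ - b₄)`

The finite non-zero branch points are `b 0, b 1, b 2, b 3`, standing for `b₁, b₂, b₃, b₄`.
Similarly the differentials `ω₁, ω₂` and the cycles `α₁, α₂` are indexed by `0, 1 : Fin 2`. -/

/-- The polynomial `-λ ∏ₖ (λ - bₖ)`. -/
def curvePoly (b : Fin 4 → ℝ) : ℂ[X] := -(X * ∏ k, (X - C (b k : ℂ)))

/-- The polynomial `Y² - (-λ ∏ₖ (λ - bₖ))` in `Y` over `ℂ(λ)`. -/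
def definingPoly (b : Fin 4 → ℝ) : (RatFunc ℂ)[X] :=
  X ^ 2 - C (algebraMap ℂ[X] (RatFunc ℂ) (curvePoly b))

theorem natDegree_curvePoly (b : Fin 4 → ℝ) : (curvePoly b).natDegree = 5 := by
  have h : (∏ k, (X - C (b k : ℂ))).Monic := monic_prod_of_monic _ _ fun k _ => monic_X_sub_C _
  rw [curvePoly, natDegree_neg, natDegree_X_mul h.ne_zero,
    natDegree_prod_of_monic _ _ fun k _ => monic_X_sub_C _]
  simp

theorem irreducible_definingPoly (b : Fin 4 → ℝ) : Irreducible (definingPoly b) := by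
  refine X_pow_sub_C_irreducible_of_prime Nat.prime_two fun r hr => ?_
  obtain ⟨g, rfl⟩ := IsIntegrallyClosed.exists_algebraMap_eq_of_isIntegral_pow
    (R := ℂ[X]) (x := r) (n := 2) (by norm_num) (hr ▸ isIntegral_algebraMap)
  rw [← map_pow] at hr
  have h := congrArg natDegree (IsFractionRing.injective ℂ[X] (RatFunc ℂ) hr)
  rw [natDegree_pow, natDegree_curvePoly] at h
  omega

instance (b : Fin 4 → ℝ) : Fact (Irreducible (definingPoly b)) := ⟨irreducible_definingPoly b⟩

/-- The field of meromorphic functions `ℂ(Γ) = ℂ(λ)[μ]`. -/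
def FunctionField (b : Fin 4 → ℝ) : Type := AdjoinRoot (definingPoly b)

instance (b : Fin 4 → ℝ) : Field (FunctionField b) :=
  inferInstanceAs (Field (AdjoinRoot (definingPoly b)))

instance (b : Fin 4 → ℝ) : Algebra (RatFunc ℂ) (FunctionField b) :=
  inferInstanceAs (Algebra (RatFunc ℂ) (AdjoinRoot (definingPoly b)))

instance (b : Fin 4 → ℝ) : Algebra ℂ (FunctionField b) :=
  inferInstanceAs (Algebra ℂ (AdjoinRoot (definingPoly b)))

instance (b : Fin 4 → ℝ) : IsScalarTower ℂ (RatFunc ℂ) (FunctionField b) :=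
  inferInstanceAs (IsScalarTower ℂ (RatFunc ℂ) (AdjoinRoot (definingPoly b)))

/-- The coordinate function `λ` on `Γ`. -/
def lam (b : Fin 4 → ℝ) : FunctionField b := algebraMap (RatFunc ℂ) (FunctionField b) RatFunc.X

/-- The coordinate function `μ` on `Γ`. -/
def mu (b : Fin 4 → ℝ) : FunctionField b := AdjoinRoot.root (definingPoly b)

/-- The holomorphic differentials `ω₁ = dλ/μ` (`j = 0`) and `ω₂ = λ dλ/μ` (`j = 1`), as elements
of the module of differentials of `ℂ(Γ)`. -/
def omega (b : Fin 4 → ℝ) (j : Fin 2) : Ω[FunctionField b⁄ℂ] :=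
  (lam b ^ (j : ℕ) / mu b) • KaehlerDifferential.D ℂ (FunctionField b) (lam b)

/-- `h` has a pole at `P₀ = (0,0)`: `h = q/p` with polynomials `p, q` in `λ, μ` such that
`p(P₀) = 0` and `q(P₀) ≠ 0`. -/
def HasPoleAtP0 (b : Fin 4 → ℝ) (h : FunctionField b) : Prop :=
  ∃ p q : MvPolynomial (Fin 2) ℂ, MvPolynomial.eval 0 p = 0 ∧ MvPolynomial.eval 0 q ≠ 0 ∧
    h * MvPolynomial.aeval ![lam b, mu b] p = MvPolynomial.aeval ![lam b, mu b] q

/-- The tangent vector `U = (A, 0)`, `A = 2 / √(-b₁ b₂ b₃ b₄)`, at the origin of the image of `Γ`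
under the Abel map `P ↦ ∫_{P₀}^P (ω₁, ω₂)`, with respect to the local coordinate `τ = √λ`
at `P₀`. -/
def tangentVector (b : Fin 4 → ℝ) : Fin 2 → ℂ :=
  ![2 / (Complex.I * (√(∏ k, b k) : ℝ)), 0]

/-! ### Coverings of elliptic curves -/

/-- A covering `π : Γ → 𝓔` of an elliptic curve `𝓔 : W² = 4 Z³ - g₂ Z - g₃` by a complex algebraic
curve `Γ` with function field `K`: a non-constant point of `𝓔` over `K`. Here `Z` and `W` are the
pull-backs of the coordinate functions of `𝓔`. -/
structure EllipticCover (K : Type) [Field K] [Algebra ℂ K] where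
  g₂ : ℂ
  g₃ : ℂ
  disc_ne_zero : g₂ ^ 3 - 27 * g₃ ^ 2 ≠ 0
  Z : K
  W : K
  equation : W ^ 2 = 4 * Z ^ 3 - algebraMap ℂ K g₂ * Z - algebraMap ℂ K g₃
  nonconstant : ∀ z : ℂ, Z ≠ algebraMap ℂ K z

namespace EllipticCover

/-- The function field `ℂ(Z, W)` of `𝓔`, as a subfield of that of `Γ`. -/
def baseField {K : Type} [Field K] [Algebra ℂ K] (π : EllipticCover K) : IntermediateField ℂ K :=
  IntermediateField.adjoin ℂ {π.Z, π.W}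

/-- The degree of the covering. -/
def degree {K : Type} [Field K] [Algebra ℂ K] (π : EllipticCover K) : ℕ :=
  Module.finrank π.baseField K

/-- The pull-back to `Γ` of the holomorphic differential `du = dZ/W` of `𝓔`. -/
def du {K : Type} [Field K] [Algebra ℂ K] (π : EllipticCover K) : Ω[K⁄ℂ] :=
  π.W⁻¹ • KaehlerDifferential.D ℂ K π.Z

/-- `π` maps `P₀` to the infinite point `Q₀` of `𝓔`. -/
def IsPointed {b : Fin 4 → ℝ} (π : EllipticCover (FunctionField b)) : Prop := HasPoleAtP0 b π.Z

/-- `π` is tangential at `P₀`. The canonical map `𝓔 → Jac Γ`, `Q ↦ π^*(Q - Q₀)`, is given by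
`Q ↦ ∑_{P ∈ π⁻¹(Q)} ∫_{P₀}^P (ω₁, ω₂)` up to a translation. By differentiation, its tangent vector
with respect to the coordinate `u` has the components `∑_{P ∈ π⁻¹(Q)} (ωⱼ/du)(P)`, that is, the
traces from `ℂ(Γ)` to `ℂ(𝓔)` of the functions `ωⱼ/du`. It is required that this vector be a
non-zero multiple of the tangent vector `U` of `Γ`, so that the canonical map is `u ↦ u U` after
rescaling `u` and the images of `𝓔` and `Γ` are tangent at the origin. -/
def IsTangential {b : Fin 4 → ℝ} (π : EllipticCover (FunctionField b)) : Prop :=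
  ∃ c : ℂ, c ≠ 0 ∧ ∀ j : Fin 2, ∃ h : FunctionField b, omega b j = h • π.du ∧
    Algebra.trace π.baseField (FunctionField b) h =
      algebraMap ℂ π.baseField (c * tangentVector b j)

end EllipticCover

/-- `(Γ, P₀)` is a hyperelliptic tangential cover of degree `N`. -/
def IsHyperellipticTangentialCover (b : Fin 4 → ℝ) (N : ℕ) : Prop :=
  ∃ π : EllipticCover (FunctionField b), π.degree = N ∧ π.IsPointed ∧ π.IsTangential

/-! ### Real periods -/

/-- `∮_{αᵢ} ωⱼ`. The cycle `α₁` (`i = 0`) goes round `[b₁, b₂]` and `α₂` (`i = 1`) goes round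
`[b₃, b₄]`; on these intervals `-λ ∏ₖ (λ - bₖ) ≥ 0`, and both cycles are oriented so that the
periods are positive. -/
def alphaPeriod (b : Fin 4 → ℝ) (i j : Fin 2) : ℝ :=
  2 * ∫ x in (![b 0, b 2] i)..(![b 1, b 3] i), x ^ (j : ℕ) / √(-(x * ∏ k, (x - b k)))

/-- The closedness condition of real geodesics: some non-trivial integer combination of `α₁, α₂`
has a positive period `T` of `ω₁` and zero period of `ω₂`. -/
def IsHill (b : Fin 4 → ℝ) : Prop :=
  ∃ m : Fin 2 → ℤ, m ≠ 0 ∧ ∃ T : ℝ, 0 < T ∧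
    ∑ i, (m i : ℝ) * alphaPeriod b i 0 = T ∧ ∑ i, (m i : ℝ) * alphaPeriod b i 1 = 0

/-! ### Geodesics on triaxial ellipsoids -/

/-- The branch points `b₁ < b₂ < b₃ < b₄` of the curve
`Γ : μ² = -λ (λ - c) (λ - a₁) (λ - a₂) (λ - a₃)` attached to the geodesics on the ellipsoid
`X₁²/a₁ + X₂²/a₂ + X₃²/a₃ = 1` with caustic parameter `c ∈ (a₁, a₃) \ {a₂}`. -/
def branchPoints (a₁ a₂ a₃ c : ℝ) : Fin 4 → ℝ :=
  if c < a₂ then ![a₁, c, a₂, a₃] else ![a₁, a₂, c, a₃]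

/-- The period mapping `φ(c)` of the geodesics with caustic parameter `c`: the ratio
`2∮_{α₂} ω₂ : 2∮_{α₁} ω₂` if `a₁ < c < a₂`, and `2∮_{α₁} ω₂ : 2∮_{α₂} ω₂` if `a₂ < c < a₃`. -/
def periodMapping (a₁ a₂ a₃ c : ℝ) : ℝ :=
  if c < a₂ then
    (2 * alphaPeriod (branchPoints a₁ a₂ a₃ c) 1 1) / (2 * alphaPeriod (branchPoints a₁ a₂ a₃ c) 0 1)
  else
    (2 * alphaPeriod (branchPoints a₁ a₂ a₃ c) 0 1) / (2 * alphaPeriod (branchPoints a₁ a₂ a₃ c) 1 1)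

end

end GeodesicCurve

/-!
In the coordinate `x = 1 / λ` the curve is `y² = g(x)` with a quintic `g`, and `P₀` is its point at
infinity. The sum of the covering and its conjugate under `y ↦ -y` is a map from the `x`-line to
`𝓔`, hence constant and, as `P₀` goes to `Q₀`, zero; so `Z = N(x) / D(x)` and `W = y T(x) / D(x)²`.
A double root of `g T²` is a critical point of `N / D`, so `T` divides the Wronskian of `N` and `D`,
with a quotient `l` such that `ω₂ / du = -1 / l(x)`. By tangency this function has trace zero, so
that `l` is not constant, and if the degree is `3`, then `l` is linear and `N'`, `D'` vanish at its
root `ρ`. It follows that `g = γ ((x - ρ)² - σ) ((x - ρ)³ - ¾ σ (x - ρ) + c)`.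

For real branch points the roots of the quadratic factor are the extreme ones, `0` and `1 / b₁`.
With `2 M = 1 / b₁` and `1 / λ = M (1 + cos θ)`, the roots of the cubic factor have the angles `a`
and `2π/3 ± a`, so that this factor is a multiple of `cos 3θ - cos 3a` and `ω₂` becomes a multiple
of `dθ / √(cos 3θ - cos 3a)`. As this is even and `2π/3`-periodic, its integral from `2π/3 - a` to
`2π/3 + a` is twice the one from `0` to `a`.
-/

namespace GeodesicCurve

section WeierstrassForm

variable {F : Type*} [Field F]

/-- The homogenized Weierstrass cubic `4 N³ - g₂ N D² - g₃ D³` of a pair of polynomials. If `N / D`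
is the first coordinate of a point of `W² = 4 Z³ - g₂ Z - g₃`, it is `D³` times the square of the
second one. -/
noncomputable def weierstrassForm (g₂ g₃ : F) (N D : F[X]) : F[X] :=
  4 * N ^ 3 - C g₂ * N * D ^ 2 - C g₃ * D ^ 3

theorem derivative_weierstrassForm (g₂ g₃ : F) (N D : F[X]) :
    derivative (weierstrassForm g₂ g₃ N D) =
      (12 * N ^ 2 - C g₂ * D ^ 2) * derivative N
        - (2 * C g₂ * N * D + 3 * C g₃ * D ^ 2) * derivative D := by
  simp only [weierstrassForm, derivative_sub, derivative_mul, derivative_C, derivative_pow,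
    derivative_ofNat, map_natCast]
  push_cast
  ring

theorem isCoprime_weierstrassForm [CharZero F] (g₂ g₃ : F) {N D : F[X]} (h : IsCoprime N D) :
    IsCoprime D (weierstrassForm g₂ g₃ N D) := by
  have h4 : IsUnit (4 : F[X]) := by
    rw [← map_ofNat C 4, isUnit_C, isUnit_iff_ne_zero]
    norm_num
  have hN : IsCoprime D (4 * N ^ 3) :=
    (isCoprime_mul_unit_left_right h4 _ _).2 h.symm.pow_right
  have hF : weierstrassForm g₂ g₃ N D = 4 * N ^ 3 + D * (-(C g₂ * N * D) - C g₃ * D ^ 2) := by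
    rw [weierstrassForm]
    ring
  exact hF ▸ hN.add_mul_left_right _

/-- The two polynomials are the partial derivatives of the binary quartic `D F(N, D)`, where `F` is
the Weierstrass form. -/
theorem isCoprime_partialDerivs [CharZero F] {g₂ g₃ : F} (hΔ : g₂ ^ 3 - 27 * g₃ ^ 2 ≠ 0)
    {N D : F[X]} (h : IsCoprime N D) :
    IsCoprime (D * (12 * N ^ 2 - C g₂ * D ^ 2))
      (4 * N ^ 3 - 3 * C g₂ * N * D ^ 2 - 4 * C g₃ * D ^ 3) := by
  set A := 12 * N ^ 2 - C g₂ * D ^ 2 with hA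
  set B := 4 * N ^ 3 - 3 * C g₂ * N * D ^ 2 - 4 * C g₃ * D ^ 3 with hB
  have hDB : IsCoprime D B := by
    convert isCoprime_weierstrassForm (3 * g₂) (4 * g₃) h using 1
    simp only [hB, weierstrassForm, map_mul, map_ofNat]
  obtain ⟨u, v, huv⟩ : IsCoprime (D ^ 4) B := hDB.pow_left
  have hunit : C (4 * (g₂ ^ 3 - 27 * g₃ ^ 2))⁻¹ * C (4 * (g₂ ^ 3 - 27 * g₃ ^ 2)) = (1 : F[X]) := by
    rw [← map_mul, inv_mul_cancel₀ (mul_ne_zero (by norm_num) hΔ), map_one]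
  have hres : (N * (6 * C g₂ * N - 9 * C g₃ * D) - 4 * C g₂ ^ 2 * D ^ 2) * A
      - 3 * (6 * C g₂ * N - 9 * C g₃ * D) * B = C (4 * (g₂ ^ 3 - 27 * g₃ ^ 2)) * D ^ 4 := by
    simp only [hA, hB, map_mul, map_sub, map_pow, map_ofNat]
    ring
  refine hDB.mul_left ⟨u * C (4 * (g₂ ^ 3 - 27 * g₃ ^ 2))⁻¹ *
    (N * (6 * C g₂ * N - 9 * C g₃ * D) - 4 * C g₂ ^ 2 * D ^ 2),
    v - u * C (4 * (g₂ ^ 3 - 27 * g₃ ^ 2))⁻¹ * (3 * (6 * C g₂ * N - 9 * C g₃ * D)), ?_⟩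
  linear_combination u * C (4 * (g₂ ^ 3 - 27 * g₃ ^ 2))⁻¹ * hres + u * D ^ 4 * hunit + huv

/-- A double root of `g T²` is a critical point of `N / D`, because the quartic `D F(N, D)` has
distinct roots. -/
theorem dvd_wronskian [CharZero F] {g₂ g₃ : F} (hΔ : g₂ ^ 3 - 27 * g₃ ^ 2 ≠ 0)
    {N D g T : F[X]} (hND : IsCoprime N D) (h : g * T ^ 2 = D * weierstrassForm g₂ g₃ N D) :
    T ∣ wronskian D N := by
  have hd := congrArg derivative h
  rw [derivative_mul, derivative_mul, derivative_weierstrassForm, derivative_pow] at hd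
  simp only [Nat.add_one_sub_one, pow_one, Nat.cast_ofNat, map_ofNat] at hd
  rw [weierstrassForm] at h hd
  have hN : T ∣ D * (12 * N ^ 2 - C g₂ * D ^ 2) * wronskian D N := by
    refine ⟨D * (derivative g * T + g * (2 * derivative T)) - 4 * g * T * derivative D, ?_⟩
    rw [wronskian]
    linear_combination (-D) * hd + 4 * derivative D * h
  have hD : T ∣ (4 * N ^ 3 - 3 * C g₂ * N * D ^ 2 - 4 * C g₃ * D ^ 3) * wronskian D N := by
    refine ⟨-(N * (derivative g * T + g * (2 * derivative T)) - 4 * g * T * derivative N), ?_⟩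
    rw [wronskian]
    linear_combination N * hd - 4 * derivative N * h
  obtain ⟨u, v, huv⟩ := isCoprime_partialDerivs hΔ hND
  rw [← one_mul (wronskian D N), ← huv, add_mul, mul_assoc u, mul_assoc v]
  exact dvd_add (hN.mul_left u) (hD.mul_left v)

theorem natDegree_weierstrassForm_of_lt [CharZero F] (g₂ g₃ : F) {N D : F[X]}
    (h : D.natDegree < N.natDegree) :
    (weierstrassForm g₂ g₃ N D).natDegree = 3 * N.natDegree := by
  have h4 : (4 * N ^ 3 : F[X]).natDegree = 3 * N.natDegree := by
    rw [← map_ofNat C 4, natDegree_C_mul (by norm_num), natDegree_pow]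
  have h₂ : (C g₂ * N * D ^ 2).natDegree < 3 * N.natDegree :=
    (natDegree_mul_le_of_le (natDegree_C_mul_le g₂ N) natDegree_pow_le).trans_lt (by omega)
  have h₃ : (C g₃ * D ^ 3).natDegree < 3 * N.natDegree :=
    ((natDegree_C_mul_le g₃ _).trans natDegree_pow_le).trans_lt (by omega)
  have h₄₂ : (4 * N ^ 3 - C g₂ * N * D ^ 2).natDegree = 3 * N.natDegree := by
    rw [natDegree_sub_eq_left_of_natDegree_lt (by rwa [h4]), h4]
  rw [weierstrassForm, natDegree_sub_eq_left_of_natDegree_lt (by rwa [h₄₂]), h₄₂]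

end WeierstrassForm

section RatFunc

variable {F : Type*} [Field F]

theorem intDegree_add_le_of_le {x y : RatFunc F} {n : ℤ} (hn : 0 ≤ n)
    (hx : x.intDegree ≤ n) (hy : y.intDegree ≤ n) : (x + y).intDegree ≤ n := by
  by_cases hy0 : y = 0
  · rwa [hy0, add_zero]
  by_cases hxy : x + y = 0
  · rwa [hxy, RatFunc.intDegree_zero]
  exact (RatFunc.intDegree_add_le hy0 hxy).trans (max_le hx hy)

theorem intDegree_add_eq_left_of_lt {x y : RatFunc F} (hx : x ≠ 0)
    (h : y.intDegree < x.intDegree) : (x + y).intDegree = x.intDegree := by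
  by_cases hy : y = 0
  · rw [hy, add_zero]
  have hxy : x + y ≠ 0 := by
    intro h0
    rw [eq_neg_of_add_eq_zero_left h0, RatFunc.intDegree_neg] at h
    exact lt_irrefl _ h
  have hle := RatFunc.intDegree_add_le hy hxy
  have hge := RatFunc.intDegree_add_le (x := x + y) (neg_ne_zero.2 hy)
    (by rwa [add_neg_cancel_right])
  rw [RatFunc.intDegree_neg, add_neg_cancel_right] at hge
  grind

theorem intDegree_mul_nonpos {x y : RatFunc F} (hx : x.intDegree ≤ 0) (hy : y.intDegree ≤ 0) :
    (x * y).intDegree ≤ 0 := by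
  by_cases hx0 : x = 0
  · rw [hx0, zero_mul, RatFunc.intDegree_zero]
  by_cases hy0 : y = 0
  · rw [hy0, mul_zero, RatFunc.intDegree_zero]
  rw [RatFunc.intDegree_mul hx0 hy0]
  exact add_nonpos hx hy

theorem intDegree_C_mul {a : F} (ha : a ≠ 0) (x : RatFunc F) :
    (RatFunc.C a * x).intDegree = x.intDegree := by
  by_cases hx : x = 0
  · rw [hx, mul_zero]
  · rw [RatFunc.intDegree_mul (by simpa using ha) hx, RatFunc.intDegree_C, zero_add]

theorem intDegree_C_mul_le {n : ℤ} (hn : 0 ≤ n) (a : F) {x : RatFunc F} (hx : x.intDegree ≤ n) :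
    (RatFunc.C a * x).intDegree ≤ n := by
  by_cases ha : a = 0
  · rwa [ha, map_zero, zero_mul, RatFunc.intDegree_zero]
  · rwa [intDegree_C_mul ha]

theorem intDegree_sq (x : RatFunc F) : (x ^ 2).intDegree = 2 * x.intDegree := by
  by_cases hx : x = 0
  · rw [hx, sq, mul_zero, RatFunc.intDegree_zero, mul_zero]
  · rw [sq, RatFunc.intDegree_mul hx hx, two_mul]

theorem intDegree_aeval_nonpos {r : RatFunc F} (hr : r.intDegree ≤ 0) (P : F[X]) :
    (aeval r P).intDegree ≤ 0 := by
  induction P using Polynomial.induction_on' with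
  | add P Q hP hQ =>
    rw [map_add]
    exact intDegree_add_le_of_le le_rfl hP hQ
  | monomial n a =>
    rw [aeval_monomial, RatFunc.algebraMap_eq_C]
    refine intDegree_C_mul_le le_rfl a ?_
    induction n with
    | zero => rw [pow_zero, RatFunc.intDegree_one]
    | succ n ih => rw [pow_succ]; exact intDegree_mul_nonpos ih hr

theorem transcendental_C_add_inv_X (a : F) :
    Transcendental F (RatFunc.C a + (RatFunc.X : RatFunc F)⁻¹) := by
  refine RatFunc.transcendental_of_ne_C _ ?_
  rintro ⟨c, hc⟩
  have h := congrArg RatFunc.intDegree (eq_sub_of_add_eq' hc)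
  rw [RatFunc.intDegree_inv, RatFunc.intDegree_X, ← map_sub, RatFunc.intDegree_C] at h
  norm_num at h

/-- The substitution `x ↦ a + 1 / x`, which moves the place `x = a` to infinity. -/
noncomputable def poleSubst (a : F) : RatFunc F →ₐ[F] RatFunc F :=
  RatFunc.liftAlgHom (aeval (RatFunc.C a + (RatFunc.X : RatFunc F)⁻¹))
    (nonZeroDivisors_le_comap_nonZeroDivisors_of_injective _
      (transcendental_iff_injective.1 (transcendental_C_add_inv_X a)))

theorem poleSubst_algebraMap (a : F) (P : F[X]) :
    poleSubst a (algebraMap F[X] (RatFunc F) P) =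
      aeval (RatFunc.C a + (RatFunc.X : RatFunc F)⁻¹) P := by
  have h := RatFunc.liftAlgHom_apply_div
    (φ := aeval (RatFunc.C a + (RatFunc.X : RatFunc F)⁻¹))
    (nonZeroDivisors_le_comap_nonZeroDivisors_of_injective _
      (transcendental_iff_injective.1 (transcendental_C_add_inv_X a))) P 1
  rwa [map_one, div_one, map_one, div_one] at h

theorem poleSubst_X (a : F) : poleSubst a RatFunc.X = RatFunc.C a + RatFunc.X⁻¹ := by
  rw [← RatFunc.algebraMap_X, poleSubst_algebraMap, aeval_X, RatFunc.algebraMap_X]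

theorem poleSubst_C (a c : F) : poleSubst a (RatFunc.C c) = RatFunc.C c := by
  rw [← RatFunc.algebraMap_eq_C]
  exact (poleSubst a).commutes c

theorem poleSubst_zero_poleSubst_zero (q : RatFunc F) : poleSubst 0 (poleSubst 0 q) = q := by
  have h : (algebraMap F[X] (RatFunc F) : F[X] → RatFunc F) =
      fun P => poleSubst 0 (poleSubst 0 (algebraMap F[X] (RatFunc F) P)) := by
    funext P
    rw [poleSubst_algebraMap, ← aeval_algHom_apply, map_add, map_inv₀, poleSubst_C, poleSubst_X]
    simp only [map_zero, zero_add, inv_inv]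
    rw [← RatFunc.algebraMap_X, aeval_algebraMap_apply, aeval_X_left_apply]
  rw [← RatFunc.num_div_denom q, map_div₀, map_div₀, ← congrFun h, ← congrFun h]

theorem poleSubst_algebraMap_ne_zero (a : F) {P : F[X]} (hP : P ≠ 0) :
    poleSubst a (algebraMap F[X] (RatFunc F) P) ≠ 0 :=
  (map_ne_zero_iff _ (poleSubst a).toRingHom.injective).2 (RatFunc.algebraMap_ne_zero hP)

theorem intDegree_poleSubst_of_isRoot {a : F} {P : F[X]} (hP : P.IsRoot a) (hP0 : P ≠ 0) :
    (poleSubst a (algebraMap F[X] (RatFunc F) P)).intDegree < 0 := by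
  have hr : (RatFunc.C a + (RatFunc.X : RatFunc F)⁻¹).intDegree ≤ 0 :=
    intDegree_add_le_of_le le_rfl (RatFunc.intDegree_C a).le
      (by rw [RatFunc.intDegree_inv, RatFunc.intDegree_X]; norm_num)
  have hX : poleSubst a (algebraMap F[X] (RatFunc F) (X - C a)) = RatFunc.X⁻¹ := by
    rw [map_sub, RatFunc.algebraMap_X, RatFunc.algebraMap_C, map_sub, poleSubst_X, poleSubst_C,
      add_sub_cancel_left]
  obtain ⟨R, rfl⟩ := dvd_iff_isRoot.2 hP
  rw [map_mul, map_mul, hX, RatFunc.intDegree_mul (inv_ne_zero RatFunc.X_ne_zero)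
    (poleSubst_algebraMap_ne_zero a (right_ne_zero_of_mul hP0)), RatFunc.intDegree_inv,
    RatFunc.intDegree_X, poleSubst_algebraMap]
  linarith [intDegree_aeval_nonpos hr R]

theorem intDegree_poleSubst_of_not_isRoot {a : F} {P : F[X]} (hP : ¬ P.IsRoot a) :
    (poleSubst a (algebraMap F[X] (RatFunc F) P)).intDegree = 0 := by
  have hC : poleSubst a (algebraMap F[X] (RatFunc F) (C (P.eval a))) = RatFunc.C (P.eval a) := by
    rw [RatFunc.algebraMap_C, poleSubst_C]
  rw [← add_sub_cancel (C (P.eval a)) P, map_add, map_add, hC]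
  by_cases h0 : P - C (P.eval a) = 0
  · rw [h0, map_zero, map_zero, add_zero, RatFunc.intDegree_C]
  have hneg := intDegree_poleSubst_of_isRoot (a := a) (by simp) h0
  rw [intDegree_add_eq_left_of_lt (by simpa using hP) (by rwa [RatFunc.intDegree_C]),
    RatFunc.intDegree_C]

theorem intDegree_poleSubst_pos {a : F} {q : RatFunc F} (h : q.denom.IsRoot a) :
    0 < (poleSubst a q).intDegree := by
  have hnum : ¬ q.num.IsRoot a := fun h' => by
    obtain ⟨u, v, huv⟩ := q.isCoprime_num_denom
    simpa [h'.eq_zero, h.eq_zero] using congrArg (eval a) huv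
  have hnum0 : q.num ≠ 0 := by
    rintro h0
    simp [h0] at hnum
  rw [← RatFunc.num_div_denom q, map_div₀, RatFunc.intDegree_div
    (poleSubst_algebraMap_ne_zero a hnum0) (poleSubst_algebraMap_ne_zero a q.denom_ne_zero),
    intDegree_poleSubst_of_not_isRoot hnum]
  linarith [intDegree_poleSubst_of_isRoot h q.denom_ne_zero]

theorem not_isRoot_denom_poleSubst_zero {q : RatFunc F} (hq : q.intDegree ≤ 0) :
    ¬ (poleSubst 0 q).denom.IsRoot 0 := fun h => by
  have := intDegree_poleSubst_pos h
  rw [poleSubst_zero_poleSubst_zero] at this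
  exact this.not_ge hq

end RatFunc

section PointsOverRatFunc

variable {F : Type*} [Field F]

/-- The equation of a point `(R, S)` on the quadratic twist by `g` of an elliptic curve over `F(x)`,
with denominators cleared. -/
theorem exists_polynomial_of_twisted_point {g₂ g₃ : F} {g : F[X]} {S R : RatFunc F}
    (hg : Squarefree g)
    (h : algebraMap F[X] (RatFunc F) g * S ^ 2 = 4 * R ^ 3 - RatFunc.C g₂ * R - RatFunc.C g₃) :
    ∃ T : F[X], S * algebraMap F[X] (RatFunc F) R.denom ^ 2 = algebraMap F[X] (RatFunc F) T ∧
      g * T ^ 2 = R.denom * weierstrassForm g₂ g₃ R.num R.denom := by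
  set ι := algebraMap F[X] (RatFunc F)
  have hC (c : F) : ι (C c) = RatFunc.C c := RatFunc.algebraMap_C c
  have hinj : Function.Injective ι := IsFractionRing.injective F[X] (RatFunc F)
  have hR : R * ι R.denom = ι R.num :=
    (div_eq_iff (RatFunc.algebraMap_ne_zero R.denom_ne_zero)).1 (RatFunc.num_div_denom R) |>.symm
  have hgS : ι g * (S * ι R.denom ^ 2) ^ 2 =
      ι (R.denom * weierstrassForm g₂ g₃ R.num R.denom) := by
    simp only [weierstrassForm, map_mul, map_sub, map_pow, map_ofNat, ← hR, hC]
    linear_combination ι R.denom ^ 4 * h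
  have hsq : (ι g * (S * ι R.denom ^ 2)) ^ 2 =
      ι (g * (R.denom * weierstrassForm g₂ g₃ R.num R.denom)) := by
    rw [map_mul, ← hgS]
    ring
  obtain ⟨U, hU⟩ := IsIntegrallyClosed.exists_algebraMap_eq_of_isIntegral_pow
    (R := F[X]) (n := 2) two_pos (hsq ▸ isIntegral_algebraMap)
  rw [← hU, ← map_pow] at hsq
  obtain ⟨T, rfl⟩ : g ∣ U := hg.isRadical 2 U ⟨_, hinj hsq⟩
  have hT : S * ι R.denom ^ 2 = ι T :=
    mul_left_cancel₀ (RatFunc.algebraMap_ne_zero hg.ne_zero) (by rw [← hU, map_mul])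
  refine ⟨T, hT, hinj ?_⟩
  rw [← hgS, hT, map_mul, map_pow]

theorem intDegree_nonpos_of_point [CharZero F] {g₂ g₃ : F} (hΔ : g₂ ^ 3 - 27 * g₃ ^ 2 ≠ 0)
    {q w : RatFunc F} (h : w ^ 2 = 4 * q ^ 3 - RatFunc.C g₂ * q - RatFunc.C g₃) :
    q.intDegree ≤ 0 := by
  by_contra! hpos
  obtain ⟨T, -, hT⟩ := exists_polynomial_of_twisted_point (g := 1) (S := w) squarefree_one
    (by rw [map_one, one_mul, h])
  have hlt : q.denom.natDegree < q.num.natDegree := by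
    rw [RatFunc.intDegree] at hpos
    omega
  have hF := natDegree_weierstrassForm_of_lt g₂ g₃ hlt
  have hF0 : weierstrassForm g₂ g₃ q.num q.denom ≠ 0 := ne_zero_of_natDegree_gt (n := 0) (by omega)
  have hdeg := congrArg natDegree hT
  rw [one_mul, natDegree_pow, natDegree_mul q.denom_ne_zero hF0, hF] at hdeg
  have hdvd := dvd_wronskian hΔ q.isCoprime_num_denom hT
  have hw : wronskian q.denom q.num ≠ 0 := fun hw => by
    have hnum := (q.isCoprime_num_denom.symm.wronskian_eq_zero_iff.1 hw).2
    rw [derivative_eq_zero.1 hnum] at hlt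
    omega
  have hle := natDegree_le_of_dvd hdvd hw
  have hwlt := natDegree_wronskian_lt_add hw
  omega

/-- If `q` had a pole in the affine line, then moving it to infinity would contradict
`intDegree_nonpos_of_point`. -/
theorem exists_eq_C_of_point [CharZero F] [IsAlgClosed F] {g₂ g₃ : F}
    (hΔ : g₂ ^ 3 - 27 * g₃ ^ 2 ≠ 0) {q w : RatFunc F}
    (h : w ^ 2 = 4 * q ^ 3 - RatFunc.C g₂ * q - RatFunc.C g₃) :
    (∃ a, q = RatFunc.C a) ∧ ∃ b, w = RatFunc.C b := by
  have hroot (a : F) : ¬ q.denom.IsRoot a := fun ha => by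
    have hpt := congrArg (poleSubst a) h
    simp only [map_pow, map_sub, map_mul, map_ofNat, poleSubst_C] at hpt
    exact (intDegree_poleSubst_pos ha).not_ge (intDegree_nonpos_of_point hΔ hpt)
  have hdenom : q.denom.natDegree = 0 := by
    by_contra h0
    obtain ⟨a, ha⟩ := IsAlgClosed.exists_root q.denom (degree_ne_of_natDegree_ne h0)
    exact hroot a ha
  have hnum : q.num.natDegree = 0 := by
    have := intDegree_nonpos_of_point hΔ h
    rw [RatFunc.intDegree, hdenom] at this
    omega
  obtain ⟨a, rfl⟩ : ∃ a, q = RatFunc.C a := by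
    obtain ⟨n, hn⟩ := natDegree_eq_zero.1 hnum
    obtain ⟨d, hd⟩ := natDegree_eq_zero.1 hdenom
    exact ⟨n / d, by rw [← RatFunc.num_div_denom q, ← hn, ← hd, RatFunc.algebraMap_C,
      RatFunc.algebraMap_C, map_div₀]⟩
  refine ⟨⟨a, rfl⟩, ?_⟩
  obtain ⟨r, hr⟩ := IsAlgClosed.exists_pow_nat_eq (4 * a ^ 3 - g₂ * a - g₃) two_pos
  have hsq : w ^ 2 = RatFunc.C r ^ 2 := by
    rw [h, ← map_pow RatFunc.C r, hr]
    simp only [map_sub, map_mul, map_pow, map_ofNat]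
  rcases sq_eq_sq_iff_eq_or_eq_neg.1 hsq with rfl | rfl
  · exact ⟨r, rfl⟩
  · exact ⟨-r, (map_neg RatFunc.C r).symm⟩

end PointsOverRatFunc

section Chord

/-- For a quadratic extension `k(√G)`, the sum of the point `(Z₀ + Z₁ √G, W₀ + W₁ √G)` and its
conjugate is a point `(q, -d)` over `k`, found by intersecting with the line of slope `L = W₁ / Z₁`
through both. -/
theorem exists_chord {k : Type*} [Field k] [CharZero k] {g₂ g₃ G Z₀ Z₁ W₀ W₁ : k} (hZ₁ : Z₁ ≠ 0)
    (h₀ : W₀ ^ 2 + W₁ ^ 2 * G = 4 * (Z₀ ^ 3 + 3 * Z₀ * Z₁ ^ 2 * G) - g₂ * Z₀ - g₃)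
    (h₁ : 2 * W₀ * W₁ = 4 * (3 * Z₀ ^ 2 * Z₁ + Z₁ ^ 3 * G) - g₂ * Z₁) :
    ∃ L q d : k, d ^ 2 = 4 * q ^ 3 - g₂ * q - g₃ ∧ Z₀ = 8⁻¹ * L ^ 2 + -2⁻¹ * q ∧
      4 * (Z₁ ^ 2 * G) = (4⁻¹ * L ^ 2 + -3 * q) ^ 2 + (2 * d * L + (g₂ - 12 * q ^ 2)) := by
  obtain ⟨L, rfl⟩ : ∃ L, W₁ = L * Z₁ := ⟨W₁ / Z₁, (div_mul_cancel₀ _ hZ₁).symm⟩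
  obtain ⟨q, rfl⟩ : ∃ q, Z₀ = 8⁻¹ * L ^ 2 + -2⁻¹ * q := ⟨4⁻¹ * L ^ 2 - 2 * Z₀, by ring⟩
  have h₁' : 2 * W₀ * L = 12 * (8⁻¹ * L ^ 2 + -2⁻¹ * q) ^ 2 + 4 * (Z₁ ^ 2 * G) - g₂ :=
    mul_left_cancel₀ hZ₁ (by linear_combination h₁)
  refine ⟨L, q, W₀ + L * (q - (8⁻¹ * L ^ 2 + -2⁻¹ * q)), ?_, rfl, ?_⟩
  · linear_combination h₀ + (q - (8⁻¹ * L ^ 2 + -2⁻¹ * q)) * h₁'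
  · linear_combination -h₁'

variable {F : Type*} [Field F]

theorem intDegree_quartic_nonpos {L : RatFunc F} (hL : L.intDegree ≤ 0) (a b d e : F) :
    ((RatFunc.C a * L ^ 2 + RatFunc.C b) ^ 2 + (RatFunc.C d * L + RatFunc.C e)).intDegree ≤ 0 := by
  have hquad : (RatFunc.C a * L ^ 2 + RatFunc.C b).intDegree ≤ 0 :=
    intDegree_add_le_of_le le_rfl (intDegree_C_mul_le le_rfl _ (by rw [intDegree_sq]; omega))
      (RatFunc.intDegree_C _).le
  refine intDegree_add_le_of_le le_rfl (by rw [intDegree_sq]; omega) ?_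
  exact intDegree_add_le_of_le le_rfl (intDegree_C_mul_le le_rfl _ hL) (RatFunc.intDegree_C _).le

theorem intDegree_quartic {L : RatFunc F} (hL : 0 < L.intDegree) {a : F} (ha : a ≠ 0) (b d e : F) :
    ((RatFunc.C a * L ^ 2 + RatFunc.C b) ^ 2 + (RatFunc.C d * L + RatFunc.C e)).intDegree =
      4 * L.intDegree := by
  have hne {q : RatFunc F} (hq : 0 < q.intDegree) : q ≠ 0 := by
    rintro rfl
    exact lt_irrefl 0 (RatFunc.intDegree_zero (K := F) ▸ hq)
  have hsq : (RatFunc.C a * L ^ 2).intDegree = 2 * L.intDegree := by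
    rw [intDegree_C_mul ha, intDegree_sq]
  have hquad : (RatFunc.C a * L ^ 2 + RatFunc.C b).intDegree = 2 * L.intDegree := by
    rw [intDegree_add_eq_left_of_lt (hne (by omega)) (by rw [RatFunc.intDegree_C]; omega), hsq]
  have hlin : (RatFunc.C d * L + RatFunc.C e).intDegree ≤ L.intDegree :=
    intDegree_add_le_of_le hL.le (intDegree_C_mul_le hL.le _ le_rfl)
      (by rw [RatFunc.intDegree_C]; exact hL.le)
  have hquad_sq : ((RatFunc.C a * L ^ 2 + RatFunc.C b) ^ 2).intDegree = 4 * L.intDegree := by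
    rw [intDegree_sq, hquad]
    ring
  rw [intDegree_add_eq_left_of_lt (hne (by omega)) (by omega), hquad_sq]

end Chord

/-- A presentation `K = ℂ(x)[y]`, `y² = g(x)`, of a field as the function field of a curve of genus
two, with `g` squarefree of degree `5`. The inclusion of `ℂ(x)` is `φ`. -/
structure QuinticModel (K : Type) [Field K] [Algebra ℂ K] where
  φ : RatFunc ℂ →ₐ[ℂ] K
  y : K
  g : ℂ[X]
  sq_y : y ^ 2 = φ (algebraMap ℂ[X] (RatFunc ℂ) g)
  natDegree_g : g.natDegree = 5
  squarefree_g : Squarefree g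
  exists_eq : ∀ z : K, ∃ A B : RatFunc ℂ, z = φ A + φ B * y

namespace QuinticModel

variable {K : Type} [Field K] [Algebra ℂ K] (m : QuinticModel K)

/-- `z` has no pole at the point of `y² = g(x)` at infinity, where `x` has a double pole and `y` a
pole of order `5`. -/
def IsRegularAtInfty (z : K) : Prop :=
  ∃ A B : RatFunc ℂ, z = m.φ A + m.φ B * m.y ∧ A.intDegree ≤ 0 ∧ (B = 0 ∨ B.intDegree ≤ -3)

/-- The coordinate function `x`. -/
noncomputable def x : K := m.φ RatFunc.X

theorem g_ne_zero : m.g ≠ 0 := m.squarefree_g.ne_zero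

theorem φ_injective : Function.Injective m.φ := m.φ.toRingHom.injective

theorem φ_C (a : ℂ) : m.φ (RatFunc.C a) = algebraMap ℂ K a := by
  rw [← RatFunc.algebraMap_eq_C]
  exact m.φ.commutes a

theorem φ_algebraMap (P : ℂ[X]) : m.φ (algebraMap ℂ[X] (RatFunc ℂ) P) = aeval m.x P := by
  rw [x, aeval_algHom_apply, ← RatFunc.algebraMap_X, aeval_algebraMap_apply, aeval_X_left_apply]

theorem aeval_x_injective : Function.Injective (aeval (R := ℂ) m.x) := fun P Q h =>
  RatFunc.algebraMap_injective ℂ (m.φ_injective (by rw [m.φ_algebraMap, m.φ_algebraMap]; exact h))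

theorem aeval_x_ne_zero {P : ℂ[X]} (hP : P ≠ 0) : aeval m.x P ≠ 0 :=
  (map_ne_zero_iff _ m.aeval_x_injective).2 hP

theorem intDegree_sq_mul_g {B : RatFunc ℂ} (hB : B ≠ 0) :
    (B ^ 2 * algebraMap ℂ[X] (RatFunc ℂ) m.g).intDegree = 2 * B.intDegree + 5 := by
  rw [RatFunc.intDegree_mul (pow_ne_zero 2 hB) (RatFunc.algebraMap_ne_zero m.g_ne_zero),
    intDegree_sq, RatFunc.intDegree_polynomial, m.natDegree_g]
  norm_num

theorem eq_zero_of_add_eq_zero {A B : RatFunc ℂ} (h : m.φ A + m.φ B * m.y = 0) :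
    A = 0 ∧ B = 0 := by
  have hB : B = 0 := by
    by_contra hB
    have hsq : A ^ 2 = B ^ 2 * algebraMap ℂ[X] (RatFunc ℂ) m.g := by
      apply m.φ_injective
      rw [map_mul, map_pow, map_pow, ← m.sq_y]
      linear_combination (m.φ A - m.φ B * m.y) * h
    have hdeg := congrArg RatFunc.intDegree hsq
    rw [intDegree_sq, m.intDegree_sq_mul_g hB] at hdeg
    omega
  exact ⟨m.φ_injective (by simpa only [hB, map_zero, zero_mul, add_zero] using h), hB⟩

theorem add_mul_y_inj {A B A' B' : RatFunc ℂ} :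
    m.φ A + m.φ B * m.y = m.φ A' + m.φ B' * m.y ↔ A = A' ∧ B = B' := by
  constructor
  · intro h
    have := m.eq_zero_of_add_eq_zero (A := A - A') (B := B - B')
      (by rw [map_sub, map_sub]; linear_combination h)
    exact ⟨sub_eq_zero.1 this.1, sub_eq_zero.1 this.2⟩
  · rintro ⟨rfl, rfl⟩
    rfl

theorem y_ne_zero : m.y ≠ 0 := fun h =>
  one_ne_zero (m.eq_zero_of_add_eq_zero (A := 0) (B := 1) (by simp [h])).2

theorem point_components {g₂ g₃ : ℂ} {Z₀ Z₁ W₀ W₁ : RatFunc ℂ}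
    (h : (m.φ W₀ + m.φ W₁ * m.y) ^ 2 = 4 * (m.φ Z₀ + m.φ Z₁ * m.y) ^ 3
      - algebraMap ℂ K g₂ * (m.φ Z₀ + m.φ Z₁ * m.y) - algebraMap ℂ K g₃) :
    W₀ ^ 2 + W₁ ^ 2 * algebraMap ℂ[X] (RatFunc ℂ) m.g =
        4 * (Z₀ ^ 3 + 3 * Z₀ * Z₁ ^ 2 * algebraMap ℂ[X] (RatFunc ℂ) m.g)
          - RatFunc.C g₂ * Z₀ - RatFunc.C g₃ ∧
      2 * W₀ * W₁ = 4 * (3 * Z₀ ^ 2 * Z₁ + Z₁ ^ 3 * algebraMap ℂ[X] (RatFunc ℂ) m.g)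
        - RatFunc.C g₂ * Z₁ := by
  rw [← m.add_mul_y_inj]
  simp only [map_add, map_sub, map_mul, map_pow, map_ofNat, m.φ_C, ← m.sq_y]
  linear_combination h

/-- The sum of `π` and its conjugate under `y ↦ -y` is a point over `ℂ(x)`, hence constant. If
`Z` is not in `ℂ(x)`, comparing degrees in the chord formulas shows that `π` is finite at infinity,
as `y²` has odd degree in `x`. -/
theorem exists_Z_eq (π : EllipticCover K) (hreg : ¬ m.IsRegularAtInfty π.Z) :
    ∃ R : RatFunc ℂ, π.Z = m.φ R := by
  obtain ⟨Z₀, Z₁, hZ⟩ := m.exists_eq π.Z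
  obtain ⟨W₀, W₁, hW⟩ := m.exists_eq π.W
  by_cases hZ₁ : Z₁ = 0
  · exact ⟨Z₀, by rw [hZ, hZ₁, map_zero, zero_mul, add_zero]⟩
  exfalso
  obtain ⟨h₀, h₁⟩ := m.point_components (hW ▸ hZ ▸ π.equation)
  obtain ⟨L, q, d, hpt, hZ₀, hdisc⟩ := exists_chord hZ₁ h₀ h₁
  obtain ⟨⟨q, rfl⟩, d, rfl⟩ := exists_eq_C_of_point π.disc_ne_zero hpt
  have hquartic : RatFunc.C 4 * (Z₁ ^ 2 * algebraMap ℂ[X] (RatFunc ℂ) m.g) =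
      (RatFunc.C 4⁻¹ * L ^ 2 + RatFunc.C (-3 * q)) ^ 2
        + (RatFunc.C (2 * d) * L + RatFunc.C (π.g₂ - 12 * q ^ 2)) := by
    simpa only [map_mul, map_sub, map_neg, map_inv₀, map_pow, map_ofNat] using hdisc
  have hdeg := congrArg RatFunc.intDegree hquartic
  rw [intDegree_C_mul (by norm_num), m.intDegree_sq_mul_g hZ₁] at hdeg
  rcases le_or_gt L.intDegree 0 with hL | hL
  · have hle := intDegree_quartic_nonpos hL 4⁻¹ (-3 * q) (2 * d) (π.g₂ - 12 * q ^ 2)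
    have hZ₀' : Z₀ = RatFunc.C 8⁻¹ * L ^ 2 + RatFunc.C (-2⁻¹ * q) := by
      simpa only [map_mul, map_neg, map_inv₀, map_ofNat] using hZ₀
    refine hreg ⟨Z₀, Z₁, hZ, ?_, Or.inr (by omega)⟩
    rw [hZ₀']
    exact intDegree_add_le_of_le le_rfl
      (intDegree_C_mul_le le_rfl _ (by rw [intDegree_sq]; omega)) (RatFunc.intDegree_C _).le
  · rw [intDegree_quartic hL (by norm_num)] at hdeg
    omega

end QuinticModel

open IntermediateField

namespace EllipticCover

variable {K : Type} [Field K] [Algebra ℂ K] (π : EllipticCover K)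

theorem Z_mem_baseField : π.Z ∈ π.baseField := subset_adjoin _ _ (Set.mem_insert _ _)

theorem W_mem_baseField : π.W ∈ π.baseField :=
  subset_adjoin _ _ (Set.mem_insert_of_mem _ (Set.mem_singleton _))

theorem adjoin_Z_le_baseField : ℂ⟮π.Z⟯ ≤ π.baseField :=
  adjoin_simple_le_iff.2 π.Z_mem_baseField

theorem relfinrank_baseField_le_two : relfinrank ℂ⟮π.Z⟯ π.baseField ≤ 2 := by
  have hext : extendScalars π.adjoin_Z_le_baseField = ℂ⟮π.Z⟯⟮π.W⟯ :=
    restrictScalars_injective ℂ (by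
      rw [extendScalars_restrictScalars, baseField, adjoin_simple_adjoin_simple])
  rw [relfinrank_eq_finrank_of_le π.adjoin_Z_le_baseField, hext]
  let z : ℂ⟮π.Z⟯ := AdjoinSimple.gen ℂ π.Z
  let p : ℂ⟮π.Z⟯[X] := X ^ 2 - C (4 * z ^ 3 - algebraMap ℂ _ π.g₂ * z - algebraMap ℂ _ π.g₃)
  have hp : p.Monic := monic_X_pow_sub_C _ two_ne_zero
  have hpW : aeval π.W p = 0 := by
    have hz : algebraMap ℂ⟮π.Z⟯ K z = π.Z := AdjoinSimple.algebraMap_gen ℂ π.Z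
    simp only [p, map_sub, map_pow, aeval_X, aeval_C, map_mul, map_ofNat, hz,
      ← IsScalarTower.algebraMap_apply, π.equation, sub_self]
  rw [adjoin.finrank ⟨p, hp, hpW⟩]
  exact (natDegree_le_of_dvd (minpoly.dvd _ _ hpW) hp.ne_zero).trans_eq (natDegree_X_pow_sub_C ..)

theorem eq_zero_of_eq_Z_mul {π : EllipticCover K} {a b : ℂ}
    (h : algebraMap ℂ K a = π.Z * algebraMap ℂ K b) : a = 0 ∧ b = 0 := by
  have hb : b = 0 := by
    by_contra hb
    refine π.nonconstant (a / b) ?_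
    rw [map_div₀, eq_div_iff ((_root_.map_ne_zero _).2 hb), h]
  exact ⟨by simpa [hb] using h, hb⟩

end EllipticCover

namespace QuinticModel

variable {K : Type} [Field K] [Algebra ℂ K] (m : QuinticModel K)

theorem finrank_fieldRange : Module.finrank m.φ.fieldRange K = 2 := by
  have hli : LinearIndependent m.φ.fieldRange ![(1 : K), m.y] := by
    rw [LinearIndependent.pair_iff]
    rintro ⟨_, A, rfl⟩ ⟨_, B, rfl⟩ h
    have h' : m.φ A + m.φ B * m.y = 0 := by
      simpa [Algebra.smul_def, IntermediateField.algebraMap_apply] using h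
    obtain ⟨rfl, rfl⟩ := m.eq_zero_of_add_eq_zero h'
    constructor <;> ext <;> simp
  have hspan : ⊤ ≤ Submodule.span m.φ.fieldRange (Set.range ![(1 : K), m.y]) := by
    rintro z -
    obtain ⟨A, B, rfl⟩ := m.exists_eq z
    rw [Matrix.range_cons, Matrix.range_cons, Matrix.range_empty, Set.union_empty,
      Set.singleton_union, Submodule.mem_span_pair]
    refine ⟨⟨m.φ A, A, rfl⟩, ⟨m.φ B, B, rfl⟩, ?_⟩
    simp [Algebra.smul_def, IntermediateField.algebraMap_apply]
  rw [Module.finrank_eq_card_basis (Module.Basis.mk hli hspan), Fintype.card_fin]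

theorem max_natDegree_ne_zero (π : EllipticCover K) {R : RatFunc ℂ} (hR : π.Z = m.φ R) :
    max R.num.natDegree R.denom.natDegree ≠ 0 := by
  intro h
  obtain ⟨a, ha⟩ := natDegree_eq_zero.1 (Nat.le_zero.1 (h ▸ le_max_left _ _))
  obtain ⟨b, hb⟩ := natDegree_eq_zero.1 (Nat.le_zero.1 (h ▸ le_max_right _ _))
  refine π.nonconstant (a / b) ?_
  rw [hR, ← RatFunc.num_div_denom R, ← ha, ← hb, RatFunc.algebraMap_C, RatFunc.algebraMap_C,
    ← map_div₀, m.φ_C]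

theorem relfinrank_fieldRange {z : K} {R : RatFunc ℂ} (hR : z = m.φ R) :
    relfinrank ℂ⟮z⟯ m.φ.fieldRange = max R.num.natDegree R.denom.natDegree := by
  have hmap : ℂ⟮z⟯ = ℂ⟮R⟯.map m.φ := by
    rw [adjoin_map, Set.image_singleton, hR]
  rw [hmap, AlgHom.fieldRange_eq_map, relfinrank_map_map, relfinrank_top_right,
    RatFunc.finrank_eq_max_natDegree]

theorem max_natDegree_eq_degree (π : EllipticCover K) (hodd : Odd π.degree) {R : RatFunc ℂ}
    (hR : π.Z = m.φ R) : max R.num.natDegree R.denom.natDegree = π.degree := by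
  have htower : relfinrank ℂ⟮π.Z⟯ π.baseField * π.degree =
      max R.num.natDegree R.denom.natDegree * 2 := by
    rw [EllipticCover.degree, relfinrank_mul_finrank_top π.adjoin_Z_le_baseField,
      ← m.relfinrank_fieldRange hR, ← m.finrank_fieldRange, relfinrank_mul_finrank_top]
    exact adjoin_simple_le_iff.2 ⟨R, hR.symm⟩
  have hle := π.relfinrank_baseField_le_two
  have hne := m.max_natDegree_ne_zero π hR
  obtain ⟨k, hk⟩ := hodd
  interval_cases relfinrank ℂ⟮π.Z⟯ π.baseField <;> omega

theorem exists_W_eq (π : EllipticCover K) (hodd : Odd π.degree) {R : RatFunc ℂ}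
    (hR : π.Z = m.φ R) : ∃ S : RatFunc ℂ, π.W = m.φ S * m.y := by
  obtain ⟨W₀, W₁, hW⟩ := m.exists_eq π.W
  have hR' : π.Z = m.φ R + m.φ 0 * m.y := by rw [hR, map_zero, zero_mul, add_zero]
  have hcross := (m.point_components (hW ▸ hR' ▸ π.equation)).2
  have hprod : 2 * (W₀ * W₁) = 0 := by linear_combination hcross
  rcases mul_eq_zero.1 ((mul_eq_zero.1 hprod).resolve_left two_ne_zero) with rfl | rfl
  · exact ⟨W₁, by rw [hW, map_zero, zero_add]⟩
  · rw [map_zero, zero_mul, add_zero] at hW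
    have hle : π.baseField ≤ m.φ.fieldRange := by
      rw [EllipticCover.baseField, adjoin_le_iff]
      rintro z (rfl | rfl)
      exacts [⟨R, hR.symm⟩, ⟨W₀, hW.symm⟩]
    have htower := relfinrank_mul_finrank_top hle
    rw [m.finrank_fieldRange] at htower
    rw [EllipticCover.degree, ← htower] at hodd
    exact absurd hodd (Nat.not_odd_iff_even.2 (even_two.mul_left _))

/-- An expression by polynomials of a covering which commutes with `y ↦ -y`: `Z = N(x) / D(x)` in
lowest terms and `W = T(x) y / D(x)²`. -/
structure EvenPresentation (π : EllipticCover K) where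
  N : ℂ[X]
  D : ℂ[X]
  T : ℂ[X]
  isCoprime : IsCoprime N D
  monic_D : D.Monic
  Z_mul : π.Z * aeval m.x D = aeval m.x N
  W_mul : π.W * aeval m.x D ^ 2 = aeval m.x T * m.y
  g_mul_sq : m.g * T ^ 2 = D * weierstrassForm π.g₂ π.g₃ N D

theorem exists_evenPresentation (π : EllipticCover K) (hodd : Odd π.degree)
    (hreg : ¬ m.IsRegularAtInfty π.Z) :
    ∃ p : m.EvenPresentation π, p.N.natDegree = π.degree ∧ p.D.natDegree < p.N.natDegree := by
  obtain ⟨R, hR⟩ := m.exists_Z_eq π hreg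
  obtain ⟨S, hS⟩ := m.exists_W_eq π hodd hR
  have hdenom : algebraMap ℂ[X] (RatFunc ℂ) R.denom ≠ 0 :=
    RatFunc.algebraMap_ne_zero R.denom_ne_zero
  have hpoint : algebraMap ℂ[X] (RatFunc ℂ) m.g * S ^ 2 =
      4 * R ^ 3 - RatFunc.C π.g₂ * R - RatFunc.C π.g₃ := by
    apply m.φ_injective
    simp only [map_sub, map_mul, map_pow, map_ofNat, m.φ_C, ← m.sq_y, ← hR, ← π.equation, hS]
    ring
  obtain ⟨T, hST, hT⟩ := exists_polynomial_of_twisted_point m.squarefree_g hpoint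
  have hdeg : R.denom.natDegree < R.num.natDegree := by
    by_contra! hle
    refine hreg ⟨R, 0, by rw [hR, map_zero, zero_mul, add_zero], ?_, Or.inl rfl⟩
    rw [RatFunc.intDegree]
    omega
  refine ⟨⟨R.num, R.denom, T, R.isCoprime_num_denom, R.monic_denom, ?_, ?_, hT⟩, ?_, hdeg⟩
  · rw [hR, ← m.φ_algebraMap, ← m.φ_algebraMap, ← map_mul]
    exact congrArg m.φ ((eq_div_iff hdenom).1 R.num_div_denom.symm)
  · rw [← m.φ_algebraMap, ← m.φ_algebraMap, ← hST, hS, map_mul m.φ S, map_pow]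
    ring
  · rw [← m.max_natDegree_eq_degree π hodd hR, max_eq_left hdeg.le]

namespace EvenPresentation

variable {m} {π : EllipticCover K} (p : m.EvenPresentation π)

theorem D_sq_smul_D_Z : aeval m.x p.D ^ 2 • KaehlerDifferential.D ℂ K π.Z =
    aeval m.x (wronskian p.D p.N) • KaehlerDifferential.D ℂ K m.x := by
  have hleibniz := congrArg (KaehlerDifferential.D ℂ K) p.Z_mul
  rw [Derivation.leibniz, Derivation.map_aeval, Derivation.map_aeval] at hleibniz
  have hsmul : aeval m.x p.D • KaehlerDifferential.D ℂ K π.Z =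
      (aeval m.x (derivative p.N) - π.Z * aeval m.x (derivative p.D)) •
        KaehlerDifferential.D ℂ K m.x := by
    rw [sub_smul, ← hleibniz, mul_smul]
    abel
  rw [sq, mul_smul, hsmul, smul_smul, wronskian, map_sub, map_mul, map_mul, ← p.Z_mul]
  congr 1
  ring

theorem quotient_mul_wronskian (hx : KaehlerDifferential.D ℂ K m.x ≠ 0) {h : K}
    (hh : (-m.y⁻¹) • KaehlerDifferential.D ℂ K m.x = h • π.du) :
    h * aeval m.x (wronskian p.D p.N) = -aeval m.x p.T := by
  have hy := m.y_ne_zero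
  have hW : π.W ≠ 0 := by
    intro hW
    rw [EllipticCover.du, hW, inv_zero, zero_smul, smul_zero] at hh
    exact smul_ne_zero (neg_ne_zero.2 (inv_ne_zero hy)) hx hh
  have hsmul : (h * aeval m.x (wronskian p.D p.N)) • KaehlerDifferential.D ℂ K m.x =
      (-aeval m.x p.T) • KaehlerDifferential.D ℂ K m.x := calc
    _ = (π.W * aeval m.x p.D ^ 2) • h • π.du := by
      rw [mul_smul, ← p.D_sq_smul_D_Z, EllipticCover.du, smul_smul, smul_smul, smul_smul]
      congr 1
      field_simp
    _ = _ := by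
      rw [← hh, smul_smul, p.W_mul]
      congr 1
      field_simp
  exact smul_left_injective K hx hsmul

theorem adjoin_inv_x_sub_eq_top (hT : p.T ≠ 0) (ρ : ℂ) :
    π.baseField⟮(m.x - algebraMap ℂ K ρ)⁻¹⟯ = ⊤ := by
  set E := π.baseField⟮(m.x - algebraMap ℂ K ρ)⁻¹⟯
  have hx : m.x ∈ E := by
    have hinv := E.inv_mem (mem_adjoin_simple_self π.baseField (m.x - algebraMap ℂ K ρ)⁻¹)
    have hρ : algebraMap ℂ K ρ ∈ E := E.algebraMap_mem (algebraMap ℂ π.baseField ρ)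
    rw [inv_inv] at hinv
    exact sub_add_cancel m.x (algebraMap ℂ K ρ) ▸ E.add_mem hinv hρ
  have hφ (A : RatFunc ℂ) : m.φ A ∈ E := by
    have hle : ℂ⟮m.x⟯ ≤ E.restrictScalars ℂ := adjoin_simple_le_iff.2 hx
    have hmap : ℂ⟮m.x⟯ = ℂ⟮(RatFunc.X : RatFunc ℂ)⟯.map m.φ := by
      rw [adjoin_map, Set.image_singleton]
      rfl
    rw [hmap, RatFunc.adjoin_X] at hle
    exact hle ⟨A, trivial, rfl⟩
  have hy : m.y ∈ E := by
    have hy : m.y = π.W * aeval m.x p.D ^ 2 / aeval m.x p.T := by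
      rw [p.W_mul, mul_div_cancel_left₀ _ (m.aeval_x_ne_zero hT)]
    rw [hy, ← m.φ_algebraMap, ← m.φ_algebraMap]
    exact E.div_mem (E.mul_mem (E.algebraMap_mem ⟨_, π.W_mem_baseField⟩) (pow_mem (hφ _) 2)) (hφ _)
  rw [eq_top_iff]
  rintro z -
  obtain ⟨A, B, rfl⟩ := m.exists_eq z
  exact E.add_mem (hφ A) (E.mul_mem (hφ B) hy)

end EvenPresentation

end QuinticModel

theorem trace_inv_eq {B K : Type*} [Field B] [Field K] [Algebra B K] [FiniteDimensional B K]
    {ξ : K} (hξ : ξ ≠ 0) (htop : B⟮ξ⁻¹⟯ = ⊤) {p : B[X]} (hdeg : p.natDegree = Module.finrank B K)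
    (hroot : aeval ξ p = 0) (hp : p.coeff 0 ≠ 0) :
    Algebra.trace B K ξ⁻¹ = -(p.coeff 1 / p.coeff 0) := by
  have hint : IsIntegral B ξ⁻¹ := Algebra.IsIntegral.isIntegral _
  have hdegmin : (minpoly B ξ⁻¹).natDegree = Module.finrank B K := by
    rw [← adjoin.finrank hint, htop, finrank_top']
  have hdvd : minpoly B ξ⁻¹ ∣ p.reverse := by
    let := invertibleOfNonzero hξ
    rw [minpoly.dvd_iff, aeval_def, ← invOf_eq_inv, eval₂_reverse_eq_zero_iff]
    exact hroot
  obtain ⟨a, ha⟩ : ∃ a, p.reverse = C a * minpoly B ξ⁻¹ :=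
    ⟨_, eq_leadingCoeff_mul_of_monic_of_dvd_of_natDegree_le (minpoly.monic hint) hdvd
      (p.reverse_natDegree_le.trans (by omega))⟩
  have hrev : p = C a * (minpoly B ξ⁻¹).reverse := by
    have := congrArg reverse ha
    rwa [reverse_mul_of_domain, reverse_C, reverse, reverse_natDegree,
      natTrailingDegree_eq_zero.2 (Or.inr hp), Nat.sub_zero, reverse, reflect_reflect] at this
  have hcoeff_zero : p.coeff 0 = a := by
    rw [hrev, coeff_C_mul, coeff_zero_reverse, minpoly.monic hint, mul_one]
  have hcoeff_one : p.coeff 1 = a * (minpoly B ξ⁻¹).nextCoeff := by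
    rw [hrev, coeff_C_mul, coeff_one_reverse]
  rw [trace_eq_finrank_mul_minpoly_nextCoeff, htop, IntermediateField.finrank_top, hcoeff_one,
    hcoeff_zero, mul_div_cancel_left₀ _ (hcoeff_zero ▸ hp), Nat.cast_one, one_mul]

namespace QuinticModel.EvenPresentation

variable {K : Type} [Field K] [Algebra ℂ K] {m : QuinticModel K} {π : EllipticCover K}
  (p : m.EvenPresentation π)

/-- The polynomial `N(ρ + X) - Z D(ρ + X)` over the function field of `𝓔`, which vanishes at
`x - ρ`. -/
noncomputable def fibrePoly (ρ : ℂ) : π.baseField[X] :=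
  (taylor ρ p.N).map (algebraMap ℂ π.baseField) -
    C ⟨π.Z, π.Z_mem_baseField⟩ * (taylor ρ p.D).map (algebraMap ℂ π.baseField)

theorem natDegree_fibrePoly (hdeg : p.D.natDegree < p.N.natDegree) (ρ : ℂ) :
    (p.fibrePoly ρ).natDegree = p.N.natDegree := by
  have hN : ((taylor ρ p.N).map (algebraMap ℂ π.baseField)).natDegree = p.N.natDegree := by
    rw [natDegree_map, natDegree_taylor]
  rw [fibrePoly, natDegree_sub_eq_left_of_natDegree_lt, hN]
  refine (natDegree_C_mul_le _ _).trans_lt ?_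
  rwa [natDegree_map, natDegree_taylor, hN]

theorem coeff_fibrePoly (ρ : ℂ) (n : ℕ) :
    algebraMap π.baseField K ((p.fibrePoly ρ).coeff n) =
      algebraMap ℂ K ((taylor ρ p.N).coeff n) - π.Z * algebraMap ℂ K ((taylor ρ p.D).coeff n) := by
  rw [fibrePoly, coeff_sub, coeff_C_mul, coeff_map, coeff_map, map_sub, map_mul]
  rfl

theorem coeff_fibrePoly_eq_zero {ρ : ℂ} {n : ℕ} (h : (p.fibrePoly ρ).coeff n = 0) :
    (taylor ρ p.N).coeff n = 0 ∧ (taylor ρ p.D).coeff n = 0 := by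
  apply EllipticCover.eq_zero_of_eq_Z_mul (π := π)
  rw [← sub_eq_zero, ← p.coeff_fibrePoly, h, map_zero]

theorem aeval_fibrePoly (ρ : ℂ) : aeval (m.x - algebraMap ℂ K ρ) (p.fibrePoly ρ) = 0 := by
  have haeval (P : ℂ[X]) : aeval (m.x - algebraMap ℂ K ρ) (taylor ρ P) = aeval m.x P := by
    rw [taylor_apply, aeval_comp, map_add, aeval_X, aeval_C, sub_add_cancel]
  rw [fibrePoly, map_sub, map_mul, aeval_C, aeval_map_algebraMap, aeval_map_algebraMap, haeval,
    haeval, ← p.Z_mul]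
  exact sub_self _

theorem coeff_zero_fibrePoly_ne_zero (ρ : ℂ) : (p.fibrePoly ρ).coeff 0 ≠ 0 := by
  intro h
  obtain ⟨hN, hD⟩ := p.coeff_fibrePoly_eq_zero h
  rw [taylor_coeff_zero] at hN hD
  obtain ⟨u, v, huv⟩ := p.isCoprime
  simpa [hN, hD] using congrArg (eval ρ) huv

theorem eval_derivative_eq_zero_of_trace (hT : p.T ≠ 0) (hN : p.N.natDegree = π.degree)
    (hdeg : p.D.natDegree < p.N.natDegree) {ρ : ℂ}
    (htr : Algebra.trace π.baseField K (m.x - algebraMap ℂ K ρ)⁻¹ = 0) :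
    (derivative p.N).eval ρ = 0 ∧ (derivative p.D).eval ρ = 0 := by
  have hfin : FiniteDimensional π.baseField K :=
    Module.finite_of_finrank_pos (by rw [EllipticCover.degree] at hN; omega)
  have hx : m.x - algebraMap ℂ K ρ ≠ 0 := by
    simpa using m.aeval_x_ne_zero (X_sub_C_ne_zero ρ)
  rw [trace_inv_eq hx (p.adjoin_inv_x_sub_eq_top hT ρ) ((p.natDegree_fibrePoly hdeg ρ).trans hN)
    (p.aeval_fibrePoly ρ) (p.coeff_zero_fibrePoly_ne_zero ρ), neg_eq_zero, div_eq_zero_iff] at htr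
  rw [← taylor_coeff_one, ← taylor_coeff_one]
  exact p.coeff_fibrePoly_eq_zero (htr.resolve_right (p.coeff_zero_fibrePoly_ne_zero ρ))

end QuinticModel.EvenPresentation

section BranchPolynomial

variable {F : Type*} [Field F] {g₂ g₃ : F} {N D Q G : F[X]} {a : F}

theorem sq_mul_sub_of_weierstrassForm (ha : a ≠ 0) (hD : D ≠ 0)
    (h : C a * (N + D * Q) * (D * Q - 2 * N) ^ 2 = C a * weierstrassForm g₂ g₃ N D) :
    Q ^ 2 * (3 * N - D * Q) = C g₂ * N + C g₃ * D := by
  refine mul_left_cancel₀ (mul_ne_zero (C_ne_zero.2 ha) (pow_ne_zero 2 hD)) ?_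
  rw [weierstrassForm] at h
  linear_combination -h

theorem exists_cubic_expansion {ρ : F} (hN : N.natDegree = 3)
    (hρ : (derivative N).eval ρ = 0) :
    ∃ ν n₂ n₀ : F, ν ≠ 0 ∧ N = C ν * (X - C ρ) ^ 3 + C n₂ * (X - C ρ) ^ 2 + C n₀ := by
  refine ⟨N.leadingCoeff, (taylor ρ N).coeff 2, N.eval ρ, ?_, ?_⟩
  · exact leadingCoeff_ne_zero.2 (ne_zero_of_natDegree_gt (n := 2) (by omega))
  conv_lhs => rw [← sum_taylor_eq N ρ, sum_over_range' _ (fun _ => by rw [C_0, zero_mul]) 4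
    (by rw [natDegree_taylor]; omega)]
  rw [← leadingCoeff_taylor ρ N, leadingCoeff, natDegree_taylor, hN, ← taylor_coeff_zero]
  simp only [Finset.sum_range_succ, Finset.sum_range_zero, taylor_coeff_one, hρ, C_0]
  ring

theorem exists_quadratic_expansion {ρ : F} (hD : D.natDegree = 2) (hmonic : D.Monic)
    (hρ : (derivative D).eval ρ = 0) : ∃ σ : F, D = (X - C ρ) ^ 2 - C σ := by
  refine ⟨-D.eval ρ, ?_⟩
  conv_lhs => rw [← sum_taylor_eq D ρ, sum_over_range' _ (fun _ => by rw [C_0, zero_mul]) 3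
    (by rw [natDegree_taylor]; omega)]
  have hlead : (taylor ρ D).coeff 2 = 1 := by
    rw [← hD, ← natDegree_taylor D ρ]
    exact (leadingCoeff_taylor ρ D).trans hmonic
  simp only [Finset.sum_range_succ, Finset.sum_range_zero, taylor_coeff_one, hρ, C_0, hlead,
    taylor_coeff_zero, C_neg, C_1]
  ring

variable [CharZero F]

theorem isCoprime_mul_sub_two_mul (hND : IsCoprime N D) : IsCoprime (D * Q - 2 * N) D := by
  have h2 : IsUnit (C (-2 : F)) := isUnit_C.2 (isUnit_iff_ne_zero.2 (by norm_num))
  have hPN : C (-2) * N + Q * D = D * Q - 2 * N := by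
    rw [C_neg, C_ofNat]
    ring
  exact hPN ▸ ((isCoprime_mul_unit_left_left h2 N D).2 hND).add_mul_right_left Q

/-- Both sides times `(D Q - 2 N)²` are congruent to `4 a N³` modulo `D²`. -/
theorem eq_mul_add_of_weierstrassForm (hND : IsCoprime N D)
    (h : G * (D * Q - 2 * N) ^ 2 = C a * weierstrassForm g₂ g₃ N D)
    (hG : G.natDegree < 2 * D.natDegree) (hN : (N + D * Q).natDegree < 2 * D.natDegree) :
    G = C a * (N + D * Q) := by
  have hdvd : D ^ 2 ∣ (G - C a * (N + D * Q)) * (D * Q - 2 * N) ^ 2 := by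
    refine ⟨C a * (3 * N * Q ^ 2 - D * Q ^ 3 - C g₂ * N - C g₃ * D), ?_⟩
    rw [sub_mul, h, weierstrassForm]
    ring
  refine sub_eq_zero.1 (eq_zero_of_dvd_of_natDegree_lt
    ((isCoprime_mul_sub_two_mul hND).pow.symm.dvd_of_dvd_mul_right hdvd) ?_)
  rw [natDegree_pow]
  exact (natDegree_sub_le_of_le le_rfl (natDegree_C_mul_le a _)).trans_lt (max_lt hG hN)

variable {ρ ν n₂ n₀ σ : F}

theorem quadratic_coeff_eq_zero (hν : ν ≠ 0)
    (hN : N = C ν * (X - C ρ) ^ 3 + C n₂ * (X - C ρ) ^ 2 + C n₀) (hD : D = (X - C ρ) ^ 2 - C σ)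
    (hQ : Q = C (3 * ν) * (X - C ρ) + C (2 * n₂))
    (h : Q ^ 2 * (3 * N - D * Q) = C g₂ * N + C g₃ * D) : n₂ = 0 := by
  by_contra hn₂
  have hQdeg : Q.natDegree = 1 := by
    rw [hQ, natDegree_add_C, natDegree_C_mul (mul_ne_zero three_ne_zero hν), natDegree_X_sub_C]
  have hdiff : 3 * N - D * Q =
      C n₂ * (X - C ρ) ^ 2 + (C (3 * ν * σ) * (X - C ρ) + C (3 * n₀ + 2 * n₂ * σ)) := by
    rw [hN, hD, hQ]
    simp only [C_add, C_mul, C_ofNat]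
    ring
  have hdiffdeg : (3 * N - D * Q).natDegree = 2 := by
    rw [hdiff]
    compute_degree!
  have hle : (C g₂ * N + C g₃ * D).natDegree ≤ 3 := by
    rw [hN, hD]
    compute_degree
  have hdeg := natDegree_mul (p := Q ^ 2) (q := 3 * N - D * Q)
    (pow_ne_zero 2 (ne_zero_of_natDegree_gt (n := 0) (by omega)))
    (ne_zero_of_natDegree_gt (n := 0) (by omega))
  rw [h, natDegree_pow] at hdeg
  omega

/-- The Chebyshev-like cubic factor is `N + D Q`, where `N' = (X - ρ) Q`. -/
theorem branch_polynomial_eq {g T : F[X]} {κ : F} (hg : g ≠ 0) (hgdeg : g.natDegree = 5)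
    (hν : ν ≠ 0) (hκ : κ ≠ 0)
    (hN : N = C ν * (X - C ρ) ^ 3 + C n₂ * (X - C ρ) ^ 2 + C n₀) (hD : D = (X - C ρ) ^ 2 - C σ)
    (hND : IsCoprime N D) (hT : g * T ^ 2 = D * weierstrassForm g₂ g₃ N D)
    (hW : wronskian D N = T * (C κ * (X - C ρ))) :
    ∃ γ c : F, g = C γ * ((X - C ρ) ^ 2 - C σ) *
      ((X - C ρ) ^ 3 - C (3 / 4 * σ) * (X - C ρ) + C c) := by
  obtain ⟨Q, hQ⟩ : ∃ Q : F[X], Q = C (3 * ν) * (X - C ρ) + C (2 * n₂) := ⟨_, rfl⟩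
  have hDdeg : D.natDegree = 2 := by rw [hD]; compute_degree!
  have hD0 : D ≠ 0 := ne_zero_of_natDegree_gt (n := 0) (by omega)
  have hP : C κ * T = D * Q - 2 * N := by
    refine mul_left_cancel₀ (X_sub_C_ne_zero ρ) ?_
    have hW' : (X - C ρ) * (C κ * T) = wronskian D N := by rw [hW]; ring
    rw [hW', wronskian, hQ, hN, hD]
    simp only [derivative_sub, derivative_add, derivative_mul, derivative_X_sub_C_pow,
      derivative_C, C_mul, C_ofNat, Nat.cast_ofNat]
    ring
  have hgP : g * (D * Q - 2 * N) ^ 2 = D * (C (κ ^ 2) * weierstrassForm g₂ g₃ N D) := by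
    rw [← hP, C_pow]
    linear_combination C κ ^ 2 * hT
  obtain ⟨G, rfl⟩ := (isCoprime_mul_sub_two_mul hND).pow_left.symm.dvd_of_dvd_mul_right ⟨_, hgP⟩
  have hGP := mul_left_cancel₀ hD0 ((mul_assoc D G _).symm.trans hgP)
  rw [natDegree_mul hD0 (right_ne_zero_of_mul hg)] at hgdeg
  have hNQdeg : (N + D * Q).natDegree ≤ 3 := by rw [hN, hD, hQ]; compute_degree
  obtain rfl := eq_mul_add_of_weierstrassForm hND hGP (by omega) (by omega)
  have hn₂ := quadratic_coeff_eq_zero hν hN hD hQ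
    (sq_mul_sub_of_weierstrassForm (pow_ne_zero 2 hκ) hD0 hGP)
  refine ⟨4 * ν * κ ^ 2, n₀ / (4 * ν), ?_⟩
  have hlin : C (4 * ν * κ ^ 2) * C (3 / 4 * σ) = C (3 * ν * κ ^ 2 * σ) := by
    rw [← C_mul]
    ring_nf
  have hconst : C (4 * ν * κ ^ 2) * C (n₀ / (4 * ν)) = C (κ ^ 2 * n₀) := by
    rw [← C_mul]
    field_simp
  rw [mul_comm (C _) (_ - _), mul_assoc, ← hD, hN, hQ, hn₂]
  congr 1
  rw [hD]
  simp only [C_mul, C_pow, C_ofNat, C_0] at hlin hconst ⊢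
  linear_combination (X - C ρ) * hlin - hconst

end BranchPolynomial

namespace QuinticModel

variable {K : Type} [Field K] [Algebra ℂ K] {m : QuinticModel K}

theorem natDegree_ne_zero_of_trace_eq_zero {π : EllipticCover K} (hπ : π.degree ≠ 0) {h : K}
    {l : ℂ[X]} (hl : h * aeval m.x l = -1) (htr : Algebra.trace π.baseField K h = 0) :
    l.natDegree ≠ 0 := by
  intro hdeg
  obtain ⟨a, rfl⟩ := natDegree_eq_zero.1 hdeg
  rw [aeval_C] at hl
  have hh : h = algebraMap π.baseField K (algebraMap ℂ π.baseField (-a⁻¹)) := by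
    rw [← IsScalarTower.algebraMap_apply, map_neg, map_inv₀]
    exact neg_eq_iff_eq_neg.1 (eq_inv_of_mul_eq_one_left (by linear_combination -hl))
  rw [hh, Algebra.trace_algebraMap, ← EllipticCover.degree, smul_eq_zero_iff_right hπ,
    _root_.map_eq_zero, neg_eq_zero, inv_eq_zero] at htr
  rw [htr, map_zero, mul_zero] at hl
  exact neg_ne_zero.2 one_ne_zero hl.symm

namespace EvenPresentation

variable {π : EllipticCover K} (p : m.EvenPresentation π)

theorem weierstrassForm_ne_zero (hdeg : p.D.natDegree < p.N.natDegree) :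
    weierstrassForm π.g₂ π.g₃ p.N p.D ≠ 0 := by
  refine ne_zero_of_natDegree_gt (n := 0) ?_
  rw [natDegree_weierstrassForm_of_lt π.g₂ π.g₃ hdeg]
  omega

theorem T_ne_zero (hdeg : p.D.natDegree < p.N.natDegree) : p.T ≠ 0 := by
  intro hT
  have h := p.g_mul_sq
  rw [hT, zero_pow two_ne_zero, mul_zero] at h
  exact mul_ne_zero p.monic_D.ne_zero (p.weierstrassForm_ne_zero hdeg) h.symm

theorem two_mul_natDegree_T (hdeg : p.D.natDegree < p.N.natDegree) :
    5 + 2 * p.T.natDegree = p.D.natDegree + 3 * p.N.natDegree := by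
  have h := congrArg natDegree p.g_mul_sq
  rwa [natDegree_mul m.g_ne_zero (pow_ne_zero 2 (p.T_ne_zero hdeg)),
    natDegree_mul p.monic_D.ne_zero (p.weierstrassForm_ne_zero hdeg), natDegree_pow,
    natDegree_weierstrassForm_of_lt π.g₂ π.g₃ hdeg, m.natDegree_g] at h

theorem exists_wronskian_eq (hT : p.T ≠ 0) (hx : KaehlerDifferential.D ℂ K m.x ≠ 0) {h : K}
    (hh : (-m.y⁻¹) • KaehlerDifferential.D ℂ K m.x = h • π.du) :
    ∃ l : ℂ[X], l ≠ 0 ∧ wronskian p.D p.N = p.T * l ∧ h * aeval m.x l = -1 := by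
  obtain ⟨l, hl⟩ := dvd_wronskian π.disc_ne_zero p.isCoprime p.g_mul_sq
  have hhl : h * aeval m.x l = -1 := by
    have hquot := p.quotient_mul_wronskian hx hh
    rw [hl, map_mul] at hquot
    exact mul_left_cancel₀ (m.aeval_x_ne_zero hT) (by linear_combination hquot)
  refine ⟨l, ?_, hl, hhl⟩
  rintro rfl
  rw [map_zero, mul_zero] at hhl
  exact neg_ne_zero.2 one_ne_zero hhl.symm

theorem exists_wronskian_eq_linear (hπ : π.degree = 3) (hN : p.N.natDegree = π.degree)
    (hdeg : p.D.natDegree < p.N.natDegree) (hx : KaehlerDifferential.D ℂ K m.x ≠ 0) {h : K}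
    (hh : (-m.y⁻¹) • KaehlerDifferential.D ℂ K m.x = h • π.du)
    (htr : Algebra.trace π.baseField K h = 0) :
    p.D.natDegree = 2 ∧ ∃ κ ρ : ℂ, κ ≠ 0 ∧ wronskian p.D p.N = p.T * (C κ * (X - C ρ)) ∧
      Algebra.trace π.baseField K (m.x - algebraMap ℂ K ρ)⁻¹ = 0 := by
  have hT := p.T_ne_zero hdeg
  obtain ⟨l, hl0, hl, hhl⟩ := p.exists_wronskian_eq hT hx hh
  have hlpos := natDegree_ne_zero_of_trace_eq_zero (by omega) hhl htr
  have hlt := natDegree_wronskian_lt_add (hl ▸ mul_ne_zero hT hl0)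
  rw [hl, natDegree_mul hT hl0] at hlt
  have hcount := p.two_mul_natDegree_T hdeg
  refine ⟨by omega, ?_⟩
  obtain ⟨κ, hκ, b, rfl⟩ := natDegree_eq_one.1 (by omega : l.natDegree = 1)
  have hlin : C κ * X + C b = C κ * (X - C (-b / κ)) := by
    rw [mul_sub, ← C_mul, mul_div_cancel₀ _ hκ, C_neg, sub_neg_eq_add]
  rw [hlin] at hl hhl
  refine ⟨κ, -b / κ, hκ, hl, ?_⟩
  have hinv : (m.x - algebraMap ℂ K (-b / κ))⁻¹ = algebraMap ℂ π.baseField (-κ) • h := by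
    rw [map_mul, aeval_C, map_sub, aeval_X, aeval_C] at hhl
    rw [Algebra.smul_def, ← IsScalarTower.algebraMap_apply, map_neg]
    exact (eq_inv_of_mul_eq_one_left (by linear_combination -hhl)).symm
  rw [hinv, map_smul, htr, smul_zero]

end EvenPresentation

theorem exists_branch_form (π : EllipticCover K) (hπ : π.degree = 3)
    (hreg : ¬ m.IsRegularAtInfty π.Z) (hx : KaehlerDifferential.D ℂ K m.x ≠ 0) {h : K}
    (hh : (-m.y⁻¹) • KaehlerDifferential.D ℂ K m.x = h • π.du)
    (htr : Algebra.trace π.baseField K h = 0) :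
    ∃ ρ σ γ c : ℂ, m.g = C γ * ((X - C ρ) ^ 2 - C σ) *
      ((X - C ρ) ^ 3 - C (3 / 4 * σ) * (X - C ρ) + C c) := by
  obtain ⟨p, hN, hdeg⟩ := m.exists_evenPresentation π (hπ ▸ by decide) hreg
  obtain ⟨hD, κ, ρ, hκ, hW, htr'⟩ := p.exists_wronskian_eq_linear hπ hN hdeg hx hh htr
  obtain ⟨hNρ, hDρ⟩ := p.eval_derivative_eq_zero_of_trace (p.T_ne_zero hdeg) hN hdeg htr'
  obtain ⟨ν, n₂, n₀, hν, hNeq⟩ := exists_cubic_expansion (hN.trans hπ) hNρ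
  obtain ⟨σ, hDeq⟩ := exists_quadratic_expansion hD p.monic_D hDρ
  exact ⟨ρ, σ, branch_polynomial_eq m.g_ne_zero m.natDegree_g hν hκ hNeq hDeq p.isCoprime
    p.g_mul_sq hW⟩

end QuinticModel

section KaehlerDifferential

variable {K : Type} [Field K] [Algebra ℂ K]

theorem QuinticModel.isIntegral_y (m : QuinticModel K) : m.φ.toRingHom.IsIntegralElem m.y := by
  refine ⟨X ^ 2 - C (algebraMap ℂ[X] (RatFunc ℂ) m.g), monic_X_pow_sub_C _ two_ne_zero, ?_⟩
  simp only [eval₂_sub, eval₂_pow, eval₂_X, eval₂_C, m.sq_y]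
  exact sub_self _

/-- `K` is separable algebraic over `ℂ(x)`, hence formally étale over `ℂ[x]`. -/
theorem QuinticModel.D_x_ne_zero (m : QuinticModel K) : KaehlerDifferential.D ℂ K m.x ≠ 0 := by
  let _ : Algebra (RatFunc ℂ) K := m.φ.toRingHom.toAlgebra
  let _ : Algebra ℂ[X] K := (aeval m.x).toAlgebra
  have : IsScalarTower ℂ[X] (RatFunc ℂ) K :=
    IsScalarTower.of_algebraMap_eq fun P => (m.φ_algebraMap P).symm
  have : IsScalarTower ℂ (RatFunc ℂ) K :=
    IsScalarTower.of_algebraMap_eq fun c => (m.φ.commutes c).symm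
  have : IsScalarTower ℂ ℂ[X] K :=
    IsScalarTower.of_algebraMap_eq fun c => ((aeval (R := ℂ) m.x).commutes c).symm
  have : Algebra.IsIntegral (RatFunc ℂ) K := by
    refine ⟨fun z => ?_⟩
    obtain ⟨A, B, rfl⟩ := m.exists_eq z
    have hφ (A : RatFunc ℂ) : IsIntegral (RatFunc ℂ) (m.φ A) := isIntegral_algebraMap (x := A)
    exact (hφ A).add ((hφ B).mul m.isIntegral_y)
  have : Algebra.FormallyEtale (RatFunc ℂ) K := Algebra.FormallyEtale.of_isSeparable _ _
  have : Algebra.FormallyEtale ℂ[X] (RatFunc ℂ) :=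
    Algebra.FormallyEtale.of_isLocalization (nonZeroDivisors ℂ[X])
  have : Algebra.FormallyEtale ℂ[X] K := Algebra.FormallyEtale.comp ℂ[X] (RatFunc ℂ) K
  intro h
  have htensor :=
    KaehlerDifferential.tensorKaehlerEquivOfFormallyEtale_symm_D_algebraMap ℂ ℂ[X] K X
  rw [show algebraMap ℂ[X] K X = m.x from aeval_X m.x, h, map_zero] at htensor
  simpa using congrArg (TensorProduct.rid ℂ[X] K ∘ (LinearMap.lTensor K
    (KaehlerDifferential.polynomialEquiv ℂ).toLinearMap)) htensor

end KaehlerDifferential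

section FunctionField

variable (b : Fin 4 → ℝ)

theorem aeval_lam (P : ℂ[X]) : aeval (lam b) P =
    algebraMap (RatFunc ℂ) (FunctionField b) (algebraMap ℂ[X] (RatFunc ℂ) P) := by
  rw [← RatFunc.aeval_X_left_eq_algebraMap]
  exact aeval_algHom_apply (IsScalarTower.toAlgHom ℂ (RatFunc ℂ) (FunctionField b)) RatFunc.X P

theorem lam_ne_zero : lam b ≠ 0 :=
  (_root_.map_ne_zero _).2 RatFunc.X_ne_zero

theorem mu_sq : mu b ^ 2 = aeval (lam b) (curvePoly b) := by
  have h : aeval (AdjoinRoot.root (definingPoly b))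
      (X ^ 2 - C (algebraMap ℂ[X] (RatFunc ℂ) (curvePoly b))) = 0 := by
    rw [AdjoinRoot.aeval_eq]
    exact AdjoinRoot.mk_self
  rw [map_sub, map_pow, aeval_X, aeval_C] at h
  rw [aeval_lam]
  exact sub_eq_zero.1 h

theorem exists_eq_add_mul_mu (z : FunctionField b) :
    ∃ A B : RatFunc ℂ, z = algebraMap (RatFunc ℂ) (FunctionField b) A +
      algebraMap (RatFunc ℂ) (FunctionField b) B * mu b := by
  obtain ⟨P, hP⟩ : ∃ P : (RatFunc ℂ)[X], eval₂ (algebraMap (RatFunc ℂ) (FunctionField b))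
      (mu b) P = z := by
    obtain ⟨P, hP⟩ := AdjoinRoot.mk_surjective (g := definingPoly b) z
    exact ⟨P, (AdjoinRoot.aeval_eq P).trans hP⟩
  rw [← hP]
  clear hP
  induction P using Polynomial.induction_on with
  | C a => exact ⟨a, 0, by rw [eval₂_C, map_zero, zero_mul, add_zero]⟩
  | add P Q hP hQ =>
    obtain ⟨A, B, h⟩ := hP
    obtain ⟨A', B', h'⟩ := hQ
    exact ⟨A + A', B + B', by rw [eval₂_add, h, h', map_add, map_add]; ring⟩
  | monomial n a ih =>
    obtain ⟨A, B, h⟩ := ih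
    refine ⟨B * algebraMap ℂ[X] (RatFunc ℂ) (curvePoly b), A, ?_⟩
    rw [pow_succ, ← mul_assoc, eval₂_mul, h, eval₂_X, map_mul, ← aeval_lam, ← mu_sq]
    ring

theorem exists_aeval_lam_mu_eq (f : MvPolynomial (Fin 2) ℂ) :
    ∃ A B : ℂ[X], MvPolynomial.aeval ![lam b, mu b] f = aeval (lam b) A + aeval (lam b) B * mu b ∧
      A.eval 0 = MvPolynomial.eval 0 f := by
  induction f using MvPolynomial.induction_on with
  | C a => exact ⟨C a, 0, by simp, by simp⟩
  | add p q hp hq =>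
    obtain ⟨A, B, h, h0⟩ := hp
    obtain ⟨A', B', h', h0'⟩ := hq
    exact ⟨A + A', B + B', by rw [map_add, h, h', map_add, map_add]; ring,
      by rw [eval_add, h0, h0', map_add]⟩
  | mul_X p i hp =>
    obtain ⟨A, B, h, -⟩ := hp
    fin_cases i
    · refine ⟨A * X, B * X, ?_, by simp⟩
      rw [map_mul, h, MvPolynomial.aeval_X, map_mul, map_mul, aeval_X]
      simp only [Fin.zero_eta, Matrix.cons_val_zero]
      ring
    · refine ⟨B * curvePoly b, A, ?_, by simp [curvePoly]⟩
      rw [map_mul, h, MvPolynomial.aeval_X, map_mul, ← mu_sq]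
      simp only [Fin.mk_one, Matrix.cons_val_one, Matrix.cons_val_fin_one]
      ring

end FunctionField

section InverseCoordinate

variable {b : Fin 4 → ℝ}

/-- The inverses `0, 1 / b₄, 1 / b₃, 1 / b₂, 1 / b₁` of the branch points of `Γ`, which increase if
`0 < b₁ < b₂ < b₃ < b₄`. -/
noncomputable def nodes (b : Fin 4 → ℝ) : Fin 5 → ℝ :=
  Fin.cons 0 fun k => (b k.rev)⁻¹

theorem nodes_injective (hb : Function.Injective b) (hb0 : ∀ k, b k ≠ 0) :
    Function.Injective (nodes b) := by
  refine Fin.cons_injective_iff.2 ⟨?_, (inv_injective.comp hb).comp Fin.rev_injective⟩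
  rintro ⟨k, hk⟩
  exact hb0 _ (inv_eq_zero.1 hk)

theorem prod_nodes {M : Type*} [CommMonoid M] (f : ℝ → M) :
    ∏ i, f (nodes b i) = f 0 * ∏ k, f (b k)⁻¹ := by
  rw [Fin.prod_univ_succ, ← Equiv.prod_comp Fin.revPerm fun k => f (b k)⁻¹]
  rfl

/-- The quintic `x⁶ f(1/x)`, where `μ² = f(λ)` is the equation of `Γ`. -/
noncomputable def invCurvePoly (b : Fin 4 → ℝ) : ℂ[X] :=
  C (-∏ k, (b k : ℂ)) * ∏ i, (X - C (nodes b i : ℂ))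

theorem neg_prod_ne_zero (hb0 : ∀ k, b k ≠ 0) : (-∏ k, (b k : ℂ)) ≠ 0 :=
  neg_ne_zero.2 (Finset.prod_ne_zero_iff.2 fun k _ => by exact_mod_cast hb0 k)

theorem natDegree_invCurvePoly (hb0 : ∀ k, b k ≠ 0) : (invCurvePoly b).natDegree = 5 := by
  rw [invCurvePoly, natDegree_C_mul (neg_prod_ne_zero hb0), natDegree_finsetProd_X_sub_C_eq_card,
    Finset.card_univ, Fintype.card_fin]

theorem squarefree_invCurvePoly (hb : Function.Injective b) (hb0 : ∀ k, b k ≠ 0) :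
    Squarefree (invCurvePoly b) := by
  have hunit : IsUnit (C (-∏ k, (b k : ℂ))) :=
    isUnit_C.2 (isUnit_iff_ne_zero.2 (neg_prod_ne_zero hb0))
  have hprod : Squarefree (∏ i, (X - C (nodes b i : ℂ))) :=
    (separable_prod_X_sub_C_iff.2
      (Complex.ofReal_injective.comp (nodes_injective hb hb0))).squarefree
  exact fun P hP => hprod P (hunit.dvd_mul_left.1 hP)

theorem aeval_inv_lam_invCurvePoly (hb0 : ∀ k, b k ≠ 0) :
    aeval (lam b)⁻¹ (invCurvePoly b) = (mu b / lam b ^ 3) ^ 2 := by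
  have hlam := lam_ne_zero b
  have hb0' (k : Fin 4) : algebraMap ℂ (FunctionField b) (b k : ℂ) ≠ 0 :=
    (_root_.map_ne_zero _).2 (by exact_mod_cast hb0 k)
  have hfactor (k : Fin 4) : (lam b)⁻¹ - (algebraMap ℂ (FunctionField b) (b k : ℂ))⁻¹ =
      -((lam b - algebraMap ℂ (FunctionField b) (b k : ℂ)) /
        (algebraMap ℂ (FunctionField b) (b k : ℂ) * lam b)) := by
    have := hb0' k
    field_simp
    ring
  have hprod := Finset.prod_ne_zero_iff.2 fun k (_ : k ∈ Finset.univ) => hb0' k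
  rw [div_pow, mu_sq, curvePoly, invCurvePoly, prod_nodes fun t => X - C (t : ℂ)]
  simp only [map_mul, map_neg, map_prod, map_sub, aeval_X, aeval_C, Complex.ofReal_zero,
    Complex.ofReal_inv, map_zero, map_inv₀, sub_zero, hfactor, Finset.prod_neg,
    Finset.prod_div_distrib, Finset.prod_mul_distrib, Finset.card_univ, Fintype.card_fin,
    Finset.prod_const]
  field_simp

/-- The inclusion of `ℂ(λ)` in `ℂ(Γ)`, with the variable of `RatFunc ℂ` standing for `1 / λ`. -/
noncomputable def invLamHom (b : Fin 4 → ℝ) : RatFunc ℂ →ₐ[ℂ] FunctionField b :=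
  (IsScalarTower.toAlgHom ℂ (RatFunc ℂ) (FunctionField b)).comp (poleSubst 0)

theorem invLamHom_X : invLamHom b RatFunc.X = (lam b)⁻¹ := by
  rw [invLamHom, AlgHom.comp_apply, poleSubst_X, map_zero, zero_add, map_inv₀]
  rfl

theorem invLamHom_poleSubst (A : RatFunc ℂ) :
    invLamHom b (poleSubst 0 A) = algebraMap (RatFunc ℂ) (FunctionField b) A := by
  rw [invLamHom, AlgHom.comp_apply, poleSubst_zero_poleSubst_zero]
  rfl

theorem invLamHom_poleSubst_mul_X_pow (B : RatFunc ℂ) :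
    invLamHom b (poleSubst 0 (B * RatFunc.X ^ 3)) * (mu b / lam b ^ 3) =
      algebraMap (RatFunc ℂ) (FunctionField b) B * mu b := by
  rw [invLamHom_poleSubst, map_mul, map_pow, mul_assoc, ← lam,
    mul_div_cancel₀ _ (pow_ne_zero 3 (lam_ne_zero b))]

theorem invLamHom_algebraMap (P : ℂ[X]) :
    invLamHom b (algebraMap ℂ[X] (RatFunc ℂ) P) = aeval (lam b)⁻¹ P := by
  rw [← RatFunc.aeval_X_left_eq_algebraMap, ← aeval_algHom_apply, invLamHom_X]

/-- The presentation of `ℂ(Γ)` by the coordinates `x = 1 / λ`, `y = μ / λ³`, in which the point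
`P₀` is at infinity. -/
noncomputable def xModel (hb : Function.Injective b) (hb0 : ∀ k, b k ≠ 0) :
    QuinticModel (FunctionField b) where
  φ := invLamHom b
  y := mu b / lam b ^ 3
  g := invCurvePoly b
  sq_y := by rw [invLamHom_algebraMap, aeval_inv_lam_invCurvePoly hb0]
  natDegree_g := natDegree_invCurvePoly hb0
  squarefree_g := squarefree_invCurvePoly hb hb0
  exists_eq z := by
    obtain ⟨A, B, rfl⟩ := exists_eq_add_mul_mu b z
    exact ⟨poleSubst 0 A, poleSubst 0 (B * RatFunc.X ^ 3), by
      rw [invLamHom_poleSubst, invLamHom_poleSubst_mul_X_pow]⟩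

variable (hb : Function.Injective b) (hb0 : ∀ k, b k ≠ 0)

theorem omega_one_eq :
    omega b 1 = (-(xModel hb hb0).y⁻¹) •
      KaehlerDifferential.D ℂ (FunctionField b) (xModel hb hb0).x := by
  have hlam := lam_ne_zero b
  rw [show (xModel hb hb0).x = (lam b)⁻¹ from invLamHom_X, Derivation.leibniz_inv, smul_smul, omega]
  congr 1
  change lam b ^ 1 / mu b = -(mu b / lam b ^ 3)⁻¹ * -(lam b)⁻¹ ^ 2
  rw [inv_div]
  field_simp

include hb hb0 in
theorem eq_zero_of_aeval_lam_add_mul_mu {P Q : ℂ[X]}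
    (h : aeval (lam b) P + aeval (lam b) Q * mu b = 0) : P = 0 := by
  rw [aeval_lam, aeval_lam, ← invLamHom_poleSubst, ← invLamHom_poleSubst_mul_X_pow] at h
  have hP := ((xModel hb hb0).eq_zero_of_add_eq_zero h).1
  by_contra hP0
  exact poleSubst_algebraMap_ne_zero 0 hP0 hP

theorem exists_mul_eq_of_intDegree_nonpos {A : RatFunc ℂ} (hA : A.intDegree ≤ 0) :
    ∃ d P : ℂ[X], d.eval 0 ≠ 0 ∧ aeval (lam b) d * invLamHom b A = aeval (lam b) P := by
  refine ⟨(poleSubst 0 A).denom, (poleSubst 0 A).num, not_isRoot_denom_poleSubst_zero hA, ?_⟩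
  rw [aeval_lam, aeval_lam, ← poleSubst_zero_poleSubst_zero A, invLamHom_poleSubst,
    poleSubst_zero_poleSubst_zero, ← map_mul, mul_comm]
  congr 1
  exact (div_eq_iff (RatFunc.algebraMap_ne_zero (RatFunc.denom_ne_zero _))).1
    (RatFunc.num_div_denom _) |>.symm

theorem exists_mul_eq_of_isRegularAtInfty {z : FunctionField b}
    (hz : (xModel hb hb0).IsRegularAtInfty z) :
    ∃ d P Q : ℂ[X], d.eval 0 ≠ 0 ∧
      aeval (lam b) d * z = aeval (lam b) P + aeval (lam b) Q * mu b := by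
  obtain ⟨A, B, rfl, hA, hB⟩ := hz
  have hB' : (B * RatFunc.X ^ 3).intDegree ≤ 0 := by
    by_cases hB0 : B = 0
    · rw [hB0, zero_mul, RatFunc.intDegree_zero]
    have hX : (RatFunc.X ^ 3 : RatFunc ℂ).intDegree = 3 := by
      rw [← RatFunc.algebraMap_X, ← map_pow, RatFunc.intDegree_polynomial, natDegree_X_pow]
      rfl
    rw [RatFunc.intDegree_mul hB0 (pow_ne_zero 3 RatFunc.X_ne_zero), hX]
    linarith [hB.resolve_left hB0]
  obtain ⟨d, P, hd, hP⟩ := exists_mul_eq_of_intDegree_nonpos (b := b) hA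
  obtain ⟨e, Q, he, hQ⟩ := exists_mul_eq_of_intDegree_nonpos (b := b) hB'
  refine ⟨d * e, e * P, d * Q, by rw [eval_mul]; exact mul_ne_zero hd he, ?_⟩
  have hlam := lam_ne_zero b
  rw [map_mul, map_pow, invLamHom_X] at hQ
  simp only [map_mul, ← hP, ← hQ]
  change aeval (lam b) d * aeval (lam b) e *
    (invLamHom b A + invLamHom b B * (mu b / lam b ^ 3)) = _
  field_simp

theorem not_isRegularAtInfty_of_hasPoleAtP0 {z : FunctionField b} (hz : HasPoleAtP0 b z) :
    ¬ (xModel hb hb0).IsRegularAtInfty z := by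
  intro hreg
  obtain ⟨d, U, V, hd, hUV⟩ := exists_mul_eq_of_isRegularAtInfty hb hb0 hreg
  obtain ⟨p, q, hp, hq, hpq⟩ := hz
  obtain ⟨P, P', hP, hP0⟩ := exists_aeval_lam_mu_eq b p
  obtain ⟨Q, Q', hQ, hQ0⟩ := exists_aeval_lam_mu_eq b q
  rw [hP, hQ] at hpq
  have hzero : aeval (lam b) (U * P + V * P' * curvePoly b - d * Q) +
      aeval (lam b) (U * P' + V * P - d * Q') * mu b = 0 := by
    simp only [map_sub, map_add, map_mul, ← mu_sq]
    linear_combination aeval (lam b) d * hpq -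
      (aeval (lam b) P + aeval (lam b) P' * mu b) * hUV
  have heval := congrArg (eval 0) (eq_zero_of_aeval_lam_add_mul_mu hb hb0 hzero)
  rw [curvePoly] at heval
  simp only [eval_sub, eval_add, eval_mul, eval_neg, eval_X, hP0, hQ0, hp, mul_zero, zero_mul,
    neg_zero, add_zero, eval_zero, zero_sub, neg_eq_zero] at heval
  exact mul_ne_zero hd hq heval

include hb hb0 in
theorem exists_invCurvePoly_eq_of_tangentialCover (h : IsHyperellipticTangentialCover b 3) :
    ∃ ρ σ γ c : ℂ, invCurvePoly b =
      C γ * ((X - C ρ) ^ 2 - C σ) * ((X - C ρ) ^ 3 - C (3 / 4 * σ) * (X - C ρ) + C c) := by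
  obtain ⟨π, hdeg, hpole, a, -, htangent⟩ := h
  obtain ⟨h, hh, htr⟩ := htangent 1
  rw [show tangentVector b 1 = 0 from rfl, mul_zero, map_zero] at htr
  rw [omega_one_eq hb hb0] at hh
  exact (xModel hb hb0).exists_branch_form π hdeg
    (not_isRegularAtInfty_of_hasPoleAtP0 hb hb0 hpole) (xModel hb hb0).D_x_ne_zero hh htr

end InverseCoordinate

section RealRoots

theorem quadratic_of_cubic {F : Type*} [Field F] {p q u v : F} (huv : u ≠ v)
    (hu : u ^ 3 - p * u + q = 0) (hv : v ^ 3 - p * v + q = 0) :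
    u ^ 2 + u * v + v ^ 2 = p := by
  refine mul_left_cancel₀ (sub_ne_zero.2 huv) ?_
  linear_combination hu - hv

theorem add_add_eq_zero_of_quadratic {F : Type*} [Field F] {p u v w : F} (hvw : v ≠ w)
    (hv : u ^ 2 + u * v + v ^ 2 = p) (hw : u ^ 2 + u * w + w ^ 2 = p) : u + v + w = 0 := by
  refine mul_left_cancel₀ (sub_ne_zero.2 hvw) ?_
  linear_combination hv - hw

theorem sq_lt_of_quadratic {u v w S : ℝ} (hvw : v ≠ w)
    (hv : u ^ 2 + u * v + v ^ 2 = 3 / 4 * S) (hw : u ^ 2 + u * w + w ^ 2 = 3 / 4 * S) :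
    u ^ 2 < S := by
  have hsum := add_add_eq_zero_of_quadratic hvw hv hw
  have hsq : 0 < (v - w) ^ 2 := sq_pos_of_ne_zero (sub_ne_zero.2 hvw)
  obtain rfl : w = -u - v := by linear_combination hsum
  linarith

/-- `x` and `y`, measured from the midpoint of `p` and `q`, are distinct roots of one cubic
`v ^ 3 - 3 / 4 * s ^ 2 * v + c`, where `s` is half the distance from `p` to `q`: the relation that
remains on elimination of `c`. -/
def CubicRelation (p q x y : ℝ) : Prop :=
  (x - (p + q) / 2) ^ 2 + (x - (p + q) / 2) * (y - (p + q) / 2) + (y - (p + q) / 2) ^ 2 =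
    3 / 4 * ((p - q) / 2) ^ 2

theorem CubicRelation.swap {p q x y : ℝ} (h : CubicRelation p q x y) : CubicRelation q p x y := by
  rw [CubicRelation] at h ⊢
  rw [add_comm q p, h]
  ring

theorem CubicRelation.mul_neg {p q x y z : ℝ} (hyz : y ≠ z) (hy : CubicRelation p q x y)
    (hz : CubicRelation p q x z) : (x - p) * (x - q) < 0 := by
  have h := sq_lt_of_quadratic (fun h => hyz (sub_left_injective h)) hy hz
  linarith

variable {ι : Type*} [Fintype ι] {t : ι → ℝ} {δ ρ σ γ c : ℂ}

theorem exists_cubicRelation (ht : Function.Injective t) (hδ : δ ≠ 0)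
    (h : C δ * ∏ i, (X - C (t i : ℂ)) = C γ * ((X - C ρ) ^ 2 - C σ) *
      ((X - C ρ) ^ 3 - C (3 / 4 * σ) * (X - C ρ) + C c)) :
    ∃ i j, ∀ k l, k ≠ l → k ≠ i → k ≠ j → l ≠ i → l ≠ j →
      CubicRelation (t i) (t j) (t k) (t l) := by
  obtain ⟨s, rfl⟩ := IsAlgClosed.exists_pow_nat_eq σ two_pos
  have heval (x : ℂ) : δ * ∏ i, (x - t i) =
      γ * ((x - ρ) ^ 2 - s ^ 2) * ((x - ρ) ^ 3 - 3 / 4 * s ^ 2 * (x - ρ) + c) := by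
    simpa only [eval_mul, eval_prod, eval_add, eval_sub, eval_pow, eval_X, eval_C] using
      congrArg (eval x) h
  have hroot {x : ℂ} (hx : (x - ρ) ^ 2 - s ^ 2 = 0) : ∃ i, x = t i := by
    have hprod := heval x
    rw [hx, mul_zero, zero_mul, mul_eq_zero, or_iff_right hδ, Finset.prod_eq_zero_iff] at hprod
    exact hprod.imp fun i hi => sub_eq_zero.1 hi.2
  obtain ⟨i, hi⟩ := hroot (x := ρ + s) (by ring)
  obtain ⟨j, hj⟩ := hroot (x := ρ - s) (by ring)
  have hγ : γ ≠ 0 := by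
    rintro rfl
    rw [C_0, zero_mul, zero_mul] at h
    exact mul_ne_zero (C_ne_zero.2 hδ) (monic_prod_X_sub_C _ _).ne_zero h
  have hcubic (k : ι) (hki : k ≠ i) (hkj : k ≠ j) :
      (t k - ρ) ^ 3 - 3 / 4 * s ^ 2 * (t k - ρ) + c = 0 := by
    have hk := heval (t k)
    rw [Finset.prod_eq_zero (Finset.mem_univ k) (sub_self _), mul_zero] at hk
    refine (mul_eq_zero.1 hk.symm).resolve_left (mul_ne_zero hγ ?_)
    have hfactor : ((t k : ℂ) - ρ) ^ 2 - s ^ 2 = (t k - t i) * (t k - t j) := by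
      rw [← hi, ← hj]
      ring
    rw [hfactor]
    exact mul_ne_zero (sub_ne_zero.2 (Complex.ofReal_injective.ne (ht.ne hki)))
      (sub_ne_zero.2 (Complex.ofReal_injective.ne (ht.ne hkj)))
  refine ⟨i, j, fun k l hkl hki hkj hli hlj => Complex.ofReal_injective ?_⟩
  have hne := (sub_left_injective (b := ρ)).ne (Complex.ofReal_injective.ne (ht.ne hkl))
  have hquad := quadratic_of_cubic hne (hcubic k hki hkj) (hcubic l hli hlj)
  push_cast
  rw [← hi, ← hj]
  linear_combination hquad

theorem cubicRelation_of_strictMono {t : Fin 5 → ℝ} (ht : StrictMono t) (hδ : δ ≠ 0)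
    (h : C δ * ∏ i, (X - C (t i : ℂ)) = C γ * ((X - C ρ) ^ 2 - C σ) *
      ((X - C ρ) ^ 3 - C (3 / 4 * σ) * (X - C ρ) + C c)) {k l : Fin 5} (hkl : k ≠ l)
    (hk₀ : k ≠ 0) (hk₄ : k ≠ 4) (hl₀ : l ≠ 0) (hl₄ : l ≠ 4) :
    CubicRelation (t 0) (t 4) (t k) (t l) := by
  obtain ⟨i, j, hij⟩ := exists_cubicRelation ht.injective hδ h
  have hbetween (k : Fin 5) (hki : k ≠ i) (hkj : k ≠ j) : (t k - t i) * (t k - t j) < 0 := by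
    obtain ⟨l, r, hlr, hkl, hkr, hli, hlj, hri, hrj⟩ :
        ∃ l r : Fin 5, l ≠ r ∧ k ≠ l ∧ k ≠ r ∧ l ≠ i ∧ l ≠ j ∧ r ≠ i ∧ r ≠ j := by
      clear * -
      decide +revert
    exact (hij k l hkl hki hkj hli hlj).mul_neg (ht.injective.ne hlr) (hij k r hkr hki hkj hri hrj)
  have hmin : 0 = i ∨ 0 = j := by
    by_contra! hne
    exact (mul_nonneg_of_nonpos_of_nonpos (sub_nonpos.2 (ht.monotone (Fin.zero_le i)))
      (sub_nonpos.2 (ht.monotone (Fin.zero_le j)))).not_gt (hbetween 0 hne.1 hne.2)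
  have hmax : 4 = i ∨ 4 = j := by
    by_contra! hne
    exact (mul_nonneg (sub_nonneg.2 (ht.monotone (Fin.le_last i)))
      (sub_nonneg.2 (ht.monotone (Fin.le_last j)))).not_gt (hbetween 4 hne.1 hne.2)
  obtain ⟨rfl, rfl⟩ | ⟨rfl, rfl⟩ : 0 = i ∧ 4 = j ∨ 4 = i ∧ 0 = j := by omega
  · exact hij k l hkl hk₀ hk₄ hl₀ hl₄
  · exact (hij k l hkl hk₄ hk₀ hl₄ hl₀).swap

end RealRoots

section AngleCoordinate

open Set MeasureTheory Real

/-- The parametrization `λ = 1 / (M (1 + cos θ))`, which makes `1 / λ - M` run through `M cos θ`. -/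
noncomputable def angleCoord (M θ : ℝ) : ℝ := (M * (1 + cos θ))⁻¹

theorem one_add_cos_pos {θ : ℝ} (hθ : θ ∈ Ico 0 π) : 0 < 1 + cos θ := by
  have h := strictAntiOn_cos ⟨hθ.1, hθ.2.le⟩ ⟨pi_pos.le, le_rfl⟩ hθ.2
  rw [cos_pi] at h
  linarith

theorem angleCoord_pos {M θ : ℝ} (hM : 0 < M) (hθ : θ ∈ Ico 0 π) : 0 < angleCoord M θ :=
  inv_pos.2 (mul_pos hM (one_add_cos_pos hθ))

theorem hasDerivAt_angleCoord {M θ : ℝ} (hM : 0 < M) (hθ : θ ∈ Ico 0 π) :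
    HasDerivAt (angleCoord M) (sin θ / (M * (1 + cos θ) ^ 2)) θ := by
  have hpos := one_add_cos_pos hθ
  refine (((hasDerivAt_cos θ).const_add 1).const_mul M |>.inv
    (mul_pos hM hpos).ne').congr_deriv ?_
  field_simp

theorem strictMonoOn_angleCoord {M : ℝ} (hM : 0 < M) : StrictMonoOn (angleCoord M) (Ico 0 π) := by
  intro x hx y hy hxy
  have hcos := strictAntiOn_cos ⟨hx.1, hx.2.le⟩ ⟨hy.1, hy.2.le⟩ hxy
  have hpos := one_add_cos_pos hy
  unfold angleCoord
  gcongr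

theorem eq_angleCoord_of_inv_div_sub_one {M x θ : ℝ} (hM : M ≠ 0) (h : x⁻¹ / M - 1 = cos θ) :
    x = angleCoord M θ := by
  rw [angleCoord, ← h, add_sub_cancel, mul_div_cancel₀ _ hM, inv_inv]

theorem angleCoord_sub {M θ φ : ℝ} (hM : M ≠ 0) (hθ : 1 + cos θ ≠ 0) (hφ : 1 + cos φ ≠ 0) :
    angleCoord M θ - angleCoord M φ = (cos φ - cos θ) * angleCoord M φ / (1 + cos θ) := by
  unfold angleCoord
  field_simp
  ring

end AngleCoordinate

section Substitution

open Set MeasureTheory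

variable {f f' G K : ℝ → ℝ} {α β : ℝ}

theorem intervalIntegrable_iff_of_strictMonoOn (hαβ : α ≤ β) (hmono : StrictMonoOn f (Icc α β))
    (hf : ContinuousOn f (Icc α β)) (hf' : ∀ θ ∈ Ioo α β, HasDerivAt f (f' θ) θ)
    (hK : ∀ θ ∈ Ioo α β, f' θ * G (f θ) = K θ) :
    IntervalIntegrable G volume (f α) (f β) ↔ IntervalIntegrable K volume α β := by
  have hle := hmono.monotoneOn (left_mem_Icc.2 hαβ) (right_mem_Icc.2 hαβ) hαβ
  rw [intervalIntegrable_iff_integrableOn_Ioo_of_le hle,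
    intervalIntegrable_iff_integrableOn_Ioo_of_le hαβ, ← hf.image_Ioo_of_strictMonoOn hαβ hmono,
    integrableOn_image_iff_integrableOn_deriv_smul_of_monotoneOn measurableSet_Ioo
      (fun θ hθ => (hf' θ hθ).hasDerivWithinAt) (hmono.monotoneOn.mono Ioo_subset_Icc_self)]
  exact integrableOn_congr_fun hK measurableSet_Ioo

theorem integral_eq_of_strictMonoOn (hαβ : α ≤ β) (hmono : StrictMonoOn f (Icc α β))
    (hf : ContinuousOn f (Icc α β)) (hf' : ∀ θ ∈ Ioo α β, HasDerivAt f (f' θ) θ)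
    (hK : ∀ θ ∈ Ioo α β, f' θ * G (f θ) = K θ) :
    ∫ x in (f α)..(f β), G x = ∫ θ in α..β, K θ := by
  have hle := hmono.monotoneOn (left_mem_Icc.2 hαβ) (right_mem_Icc.2 hαβ) hαβ
  rw [intervalIntegral.integral_of_le hle, intervalIntegral.integral_of_le hαβ,
    integral_Ioc_eq_integral_Ioo, integral_Ioc_eq_integral_Ioo,
    ← hf.image_Ioo_of_strictMonoOn hαβ hmono,
    integral_image_eq_integral_deriv_smul_of_monotoneOn measurableSet_Ioo
      (fun θ hθ => (hf' θ hθ).hasDerivWithinAt) (hmono.monotoneOn.mono Ioo_subset_Icc_self)]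
  exact setIntegral_congr_fun measurableSet_Ioo hK

end Substitution

section EvenPeriodic

open MeasureTheory

variable {E : Type*} [NormedAddCommGroup E] {f : ℝ → E} {p a : ℝ}

theorem intervalIntegrable_sub_of_even_of_periodic (heven : Function.Even f)
    (hper : Function.Periodic f p) (hf : IntervalIntegrable f volume 0 a) :
    IntervalIntegrable f volume (p - a) p := by
  have h := (hf.comp_sub_left p).symm
  simpa only [sub_zero, hper.sub_eq', heven _] using h

theorem intervalIntegrable_add_of_periodic (hper : Function.Periodic f p)
    (hf : IntervalIntegrable f volume 0 a) : IntervalIntegrable f volume p (p + a) := by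
  have h := hf.comp_sub_right p
  simpa only [zero_add, hper.sub_eq, add_comm a] using h

theorem integral_sub_add_of_even_of_periodic [NormedSpace ℝ E] (heven : Function.Even f)
    (hper : Function.Periodic f p) (hf : IntervalIntegrable f volume 0 a) :
    ∫ θ in (p - a)..(p + a), f θ = 2 • ∫ θ in 0..a, f θ := by
  have hsub : ∫ θ in (p - a)..p, f θ = ∫ θ in 0..a, f θ := by
    have h := intervalIntegral.integral_comp_sub_left f p (a := 0) (b := a)
    simpa only [sub_zero, hper.sub_eq', heven _] using h.symm
  have hadd : ∫ θ in p..(p + a), f θ = ∫ θ in 0..a, f θ := by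
    have h := intervalIntegral.integral_comp_add_left f p (a := 0) (b := a)
    simpa only [zero_add, add_comm p, hper _] using h.symm
  rw [← intervalIntegral.integral_add_adjacent_intervals
    (intervalIntegrable_sub_of_even_of_periodic heven hper hf)
    (intervalIntegrable_add_of_periodic hper hf), hsub, hadd, two_nsmul]

end EvenPeriodic

section CosineKernel

open Set MeasureTheory Real

theorem exists_mul_sub_le_cos_sub_cos {b : ℝ} (hb : 0 < b) (hbπ : b < π) :
    ∃ c, 0 < c ∧ ∀ x ∈ Ioo 0 b, c * (b - x) ≤ cos x - cos b := by
  have hm : 0 < min (sin (b / 2)) (sin b) :=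
    lt_min (sin_pos_of_pos_of_lt_pi (by linarith) (by linarith)) (sin_pos_of_pos_of_lt_pi hb hbπ)
  refine ⟨2 * min (sin (b / 2)) (sin b) * π⁻¹, by positivity, fun x hx => ?_⟩
  have hsum : min (sin (b / 2)) (sin b) ≤ sin ((b + x) / 2) :=
    strictConcaveOn_sin_Icc.concaveOn.min_le_of_mem_Icc ⟨by linarith, by linarith⟩
      ⟨hb.le, hbπ.le⟩ ⟨by linarith [hx.1], by linarith [hx.2]⟩
  have hdiff : π⁻¹ * (b - x) ≤ sin ((b - x) / 2) := by
    refine (mul_le_sin (x := (b - x) / 2) (by linarith [hx.2]) (by linarith [hx.1])).trans_eq' ?_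
    ring
  have hnonneg : 0 ≤ π⁻¹ * (b - x) := mul_nonneg (by positivity) (by linarith [hx.2])
  calc 2 * min (sin (b / 2)) (sin b) * π⁻¹ * (b - x)
      = 2 * (min (sin (b / 2)) (sin b) * (π⁻¹ * (b - x))) := by ring
    _ ≤ 2 * (sin ((b + x) / 2) * sin ((b - x) / 2)) :=
      mul_le_mul_of_nonneg_left (mul_le_mul hsum hdiff hnonneg (hm.le.trans hsum)) two_pos.le
    _ = cos x - cos b := by
      rw [cos_sub_cos, ← neg_sub b x, neg_div, sin_neg, add_comm b]
      ring

theorem intervalIntegrable_inv_sqrt_cos_sub_cos {b : ℝ} (hb : 0 < b) (hbπ : b < π) :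
    IntervalIntegrable (fun x => (√(cos x - cos b))⁻¹) volume 0 b := by
  obtain ⟨c, hc, hbound⟩ := exists_mul_sub_le_cos_sub_cos hb hbπ
  have hdom : IntervalIntegrable (fun x => (√c)⁻¹ * (b - x) ^ (-(1 / 2) : ℝ)) volume 0 b := by
    have h := (intervalIntegral.intervalIntegrable_rpow' (a := b) (b := 0)
      (r := -(1 / 2)) (by norm_num)).comp_sub_left b
    rw [sub_self, sub_zero] at h
    exact h.const_mul _
  rw [intervalIntegrable_iff_integrableOn_Ioo_of_le hb.le] at hdom ⊢
  refine Integrable.mono' hdom (Measurable.aestronglyMeasurable (by fun_prop)) ?_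
  refine (ae_restrict_iff' measurableSet_Ioo).2 (Filter.Eventually.of_forall fun x hx => ?_)
  have hx' : 0 < b - x := sub_pos.2 hx.2
  rw [norm_of_nonneg (by positivity), rpow_neg hx'.le, ← sqrt_eq_rpow, ← mul_inv,
    ← sqrt_mul hc.le]
  exact inv_anti₀ (sqrt_pos.2 (mul_pos hc hx')) (sqrt_le_sqrt (hbound x hx))

/-- The density of `ω₂` in the angular coordinate, up to a constant factor. -/
noncomputable def cosKernel (a θ : ℝ) : ℝ := (√(cos (3 * θ) - cos (3 * a)))⁻¹

theorem intervalIntegrable_cosKernel {a : ℝ} (ha : 0 < a) (ha' : a < π / 3) :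
    IntervalIntegrable (cosKernel a) volume 0 a := by
  have h := (intervalIntegrable_inv_sqrt_cos_sub_cos (b := 3 * a) (by linarith)
    (by linarith)).comp_mul_left (c := 3)
  rwa [zero_div, mul_div_cancel_left₀ a three_ne_zero] at h

theorem even_cosKernel (a : ℝ) : Function.Even (cosKernel a) := fun θ => by
  rw [cosKernel, cosKernel, mul_neg, cos_neg]

theorem periodic_cosKernel (a : ℝ) : Function.Periodic (cosKernel a) (2 * π / 3) := fun θ => by
  rw [cosKernel, cosKernel, mul_add, mul_div_cancel₀ _ three_ne_zero, cos_add_two_pi]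

end CosineKernel

section AngleBranchPoints

open Set MeasureTheory Real

theorem cos_two_pi_div_three : cos (2 * π / 3) = -(1 / 2) := by
  rw [show 2 * π / 3 = π - π / 3 by ring, cos_pi_sub, cos_pi_div_three]

theorem sin_two_pi_div_three : sin (2 * π / 3) = √3 / 2 := by
  rw [show 2 * π / 3 = π - π / 3 by ring, sin_pi_sub, sin_pi_div_three]

/-- The angles of the branch points: apart from `0`, the solutions of `cos (3 θ) = cos (3 a)` in
`[0, π]`. -/
noncomputable def branchAngles (a : ℝ) : Fin 4 → ℝ := ![0, a, 2 * π / 3 - a, 2 * π / 3 + a]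

/-- The branch points whose angles are `branchAngles a`. -/
noncomputable def angleBranchPoints (M a : ℝ) (k : Fin 4) : ℝ := angleCoord M (branchAngles a k)

theorem branchAngles_mem_Ico {a : ℝ} (ha : 0 < a) (ha' : a < π / 3) (k : Fin 4) :
    branchAngles a k ∈ Ico 0 π := by
  fin_cases k
  exacts [⟨le_rfl, pi_pos⟩, ⟨ha.le, ha'.trans (by linarith [pi_pos])⟩,
    ⟨show 0 ≤ 2 * π / 3 - a by linarith, show 2 * π / 3 - a < π by linarith⟩,
    ⟨show 0 ≤ 2 * π / 3 + a by linarith, show 2 * π / 3 + a < π by linarith⟩]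

theorem prod_cos_branchAngles_sub_cos (θ a : ℝ) :
    ∏ k, (cos (branchAngles a k) - cos θ) =
      -((1 - cos θ) * (cos (3 * θ) - cos (3 * a)) / 4) := by
  have h3 : √3 ^ 2 = (3 : ℝ) := sq_sqrt (by norm_num)
  simp only [Fin.prod_univ_four, branchAngles, Matrix.cons_val]
  rw [cos_sub, cos_add, cos_two_pi_div_three, sin_two_pi_div_three, cos_three_mul, cos_three_mul,
    cos_zero]
  linear_combination (1 - cos θ) * (cos θ - cos a) *
    (1 / 4 * sin a ^ 2 * h3 + 3 / 4 * sin_sq_add_cos_sq a)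

variable {M a : ℝ}

theorem prod_angleBranchPoints_pos (hM : 0 < M) (ha : 0 < a) (ha' : a < π / 3) :
    0 < ∏ k, angleBranchPoints M a k :=
  Finset.prod_pos fun k _ => angleCoord_pos hM (branchAngles_mem_Ico ha ha' k)

theorem prod_angleCoord_sub_angleBranchPoints {θ : ℝ} (hM : 0 < M) (ha : 0 < a)
    (ha' : a < π / 3) (hθ : θ ∈ Ico 0 π) :
    ∏ k, (angleCoord M θ - angleBranchPoints M a k) =
      -((1 - cos θ) * (cos (3 * θ) - cos (3 * a)) / 4) * (∏ k, angleBranchPoints M a k) /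
        (1 + cos θ) ^ 4 := by
  rw [← prod_cos_branchAngles_sub_cos, ← Finset.prod_mul_distrib]
  simp only [angleBranchPoints, angleCoord_sub hM.ne' (one_add_cos_pos hθ).ne'
    (one_add_cos_pos (branchAngles_mem_Ico ha ha' _)).ne', Finset.prod_div_distrib,
    Finset.prod_const, Finset.card_univ, Fintype.card_fin]

theorem neg_mul_prod_angleCoord_sub {θ : ℝ} (hM : 0 < M) (ha : 0 < a) (ha' : a < π / 3)
    (hθ : θ ∈ Ico 0 π) :
    -(angleCoord M θ * ∏ k, (angleCoord M θ - angleBranchPoints M a k)) =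
      (sin θ / (M * (1 + cos θ) ^ 2) * angleCoord M θ) ^ 2 *
        (M ^ 3 * (∏ k, angleBranchPoints M a k) / 4) * (cos (3 * θ) - cos (3 * a)) := by
  have hpos := one_add_cos_pos hθ
  have hsin : sin θ ^ 2 = (1 - cos θ) * (1 + cos θ) := by
    linear_combination sin_sq_add_cos_sq θ
  rw [prod_angleCoord_sub_angleBranchPoints hM ha ha' hθ, mul_pow, div_pow, hsin, angleCoord]
  field_simp

/-- The real function `λ ^ j / √(-λ ∏ₖ (λ - bₖ))` whose integrals are the real periods of
`ω_{j+1}`. -/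
noncomputable def omegaDensity (b : Fin 4 → ℝ) (j : Fin 2) (x : ℝ) : ℝ :=
  x ^ (j : ℕ) / √(-(x * ∏ k, (x - b k)))

theorem deriv_mul_omegaDensity_angleCoord {θ : ℝ} (hM : 0 < M) (ha : 0 < a) (ha' : a < π / 3)
    (hθ : θ ∈ Ioo 0 π) :
    sin θ / (M * (1 + cos θ) ^ 2) * omegaDensity (angleBranchPoints M a) 1 (angleCoord M θ) =
      (√(M ^ 3 * (∏ k, angleBranchPoints M a k) / 4))⁻¹ * cosKernel a θ := by
  have hθ' : θ ∈ Ico 0 π := Ioo_subset_Ico_self hθ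
  have hpos := one_add_cos_pos hθ'
  have hprod := prod_angleBranchPoints_pos hM ha ha'
  have hfactor : 0 < sin θ / (M * (1 + cos θ) ^ 2) * angleCoord M θ :=
    mul_pos (div_pos (sin_pos_of_pos_of_lt_pi hθ.1 hθ.2) (by positivity)) (angleCoord_pos hM hθ')
  rw [omegaDensity, neg_mul_prod_angleCoord_sub hM ha ha' hθ', sqrt_mul (by positivity),
    sqrt_mul (sq_nonneg _), sqrt_sq hfactor.le, cosKernel, Fin.val_one, pow_one, ← mul_div_assoc,
    mul_assoc, ← div_div, div_self hfactor.ne', one_div, mul_inv]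

theorem intervalIntegrable_omegaDensity_angleCoord {α β : ℝ} (hM : 0 < M) (ha : 0 < a)
    (ha' : a < π / 3) (hα : 0 ≤ α) (hαβ : α ≤ β) (hβ : β < π)
    (h : IntervalIntegrable (cosKernel a) volume α β) :
    IntervalIntegrable (omegaDensity (angleBranchPoints M a) 1) volume (angleCoord M α)
      (angleCoord M β) := by
  have hsub : Icc α β ⊆ Ico 0 π := fun θ hθ => ⟨hα.trans hθ.1, hθ.2.trans_lt hβ⟩
  exact (intervalIntegrable_iff_of_strictMonoOn hαβ ((strictMonoOn_angleCoord hM).mono hsub)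
    (fun θ hθ => (hasDerivAt_angleCoord hM (hsub hθ)).continuousAt.continuousWithinAt)
    (fun θ hθ => hasDerivAt_angleCoord hM (hsub (Ioo_subset_Icc_self hθ)))
    fun θ hθ => deriv_mul_omegaDensity_angleCoord hM ha ha'
      ⟨hα.trans_lt hθ.1, hθ.2.trans hβ⟩).2 (h.const_mul _)

theorem integral_omegaDensity_angleCoord {α β : ℝ} (hM : 0 < M) (ha : 0 < a)
    (ha' : a < π / 3) (hα : 0 ≤ α) (hαβ : α ≤ β) (hβ : β < π) :
    ∫ x in (angleCoord M α)..(angleCoord M β), omegaDensity (angleBranchPoints M a) 1 x =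
      (√(M ^ 3 * (∏ k, angleBranchPoints M a k) / 4))⁻¹ * ∫ θ in α..β, cosKernel a θ := by
  have hsub : Icc α β ⊆ Ico 0 π := fun θ hθ => ⟨hα.trans hθ.1, hθ.2.trans_lt hβ⟩
  rw [← intervalIntegral.integral_const_mul]
  exact integral_eq_of_strictMonoOn hαβ ((strictMonoOn_angleCoord hM).mono hsub)
    (fun θ hθ => (hasDerivAt_angleCoord hM (hsub hθ)).continuousAt.continuousWithinAt)
    (fun θ hθ => hasDerivAt_angleCoord hM (hsub (Ioo_subset_Icc_self hθ)))
    fun θ hθ => deriv_mul_omegaDensity_angleCoord hM ha ha' ⟨hα.trans_lt hθ.1, hθ.2.trans hβ⟩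

theorem intervalIntegrable_omegaDensity_left (hM : 0 < M) (ha : 0 < a) (ha' : a < π / 3) :
    IntervalIntegrable (omegaDensity (angleBranchPoints M a) 1) volume (angleBranchPoints M a 0)
      (angleBranchPoints M a 1) :=
  intervalIntegrable_omegaDensity_angleCoord hM ha ha' le_rfl ha.le
    (branchAngles_mem_Ico ha ha' 1).2 (intervalIntegrable_cosKernel ha ha')

theorem intervalIntegrable_omegaDensity_right (hM : 0 < M) (ha : 0 < a) (ha' : a < π / 3) :
    IntervalIntegrable (omegaDensity (angleBranchPoints M a) 1) volume (angleBranchPoints M a 2)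
      (angleBranchPoints M a 3) :=
  intervalIntegrable_omegaDensity_angleCoord hM ha ha' (branchAngles_mem_Ico ha ha' 2).1
    (show 2 * π / 3 - a ≤ 2 * π / 3 + a by linarith) (branchAngles_mem_Ico ha ha' 3).2
    ((intervalIntegrable_sub_of_even_of_periodic (even_cosKernel a) (periodic_cosKernel a)
      (intervalIntegrable_cosKernel ha ha')).trans
    (intervalIntegrable_add_of_periodic (periodic_cosKernel a)
      (intervalIntegrable_cosKernel ha ha')))

theorem alphaPeriod_one_one_angleBranchPoints (hM : 0 < M) (ha : 0 < a) (ha' : a < π / 3) :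
    alphaPeriod (angleBranchPoints M a) 1 1 = 2 * alphaPeriod (angleBranchPoints M a) 0 1 := by
  have hleft := integral_omegaDensity_angleCoord hM ha ha' le_rfl ha.le (by linarith)
  have hright := integral_omegaDensity_angleCoord hM ha ha' (α := 2 * π / 3 - a)
    (β := 2 * π / 3 + a) (by linarith) (by linarith) (by linarith)
  rw [integral_sub_add_of_even_of_periodic (even_cosKernel a) (periodic_cosKernel a)
    (intervalIntegrable_cosKernel ha ha'), nsmul_eq_mul, mul_left_comm, ← hleft] at hright
  exact congrArg (2 * ·) hright

end AngleBranchPoints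

section PeriodComparison

open Set MeasureTheory

variable {f : ℝ → ℝ} {u v : ℝ}

theorem intervalIntegrable_of_id_mul (hu : 0 < u) (huv : u ≤ v)
    (hf : IntervalIntegrable (fun x => x * f x) volume u v) : IntervalIntegrable f volume u v := by
  have hpos {x : ℝ} (hx : x ∈ Icc u v) : x ≠ 0 := (hu.trans_le hx.1).ne'
  have hinv : ContinuousOn (fun x : ℝ => x⁻¹) (uIcc u v) :=
    continuousOn_inv₀.mono fun x hx => hpos (uIcc_of_le huv ▸ hx)
  refine (hf.continuousOn_mul hinv).congr fun x hx => inv_mul_cancel_left₀ (hpos ?_) (f x)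
  exact Ioc_subset_Icc_self (uIoc_of_le huv ▸ hx)

theorem mul_integral_le_integral_id_mul (hu : 0 < u) (huv : u ≤ v) (hnonneg : ∀ x, 0 ≤ f x)
    (hf : IntervalIntegrable (fun x => x * f x) volume u v) :
    u * ∫ x in u..v, f x ≤ ∫ x in u..v, x * f x := by
  rw [← intervalIntegral.integral_const_mul]
  exact intervalIntegral.integral_mono_on huv
    ((intervalIntegrable_of_id_mul hu huv hf).const_mul u) hf
    fun x hx => mul_le_mul_of_nonneg_right hx.1 (hnonneg x)

theorem integral_id_mul_le_mul_integral (hu : 0 < u) (huv : u ≤ v) (hnonneg : ∀ x, 0 ≤ f x)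
    (hf : IntervalIntegrable (fun x => x * f x) volume u v) :
    ∫ x in u..v, x * f x ≤ v * ∫ x in u..v, f x := by
  rw [← intervalIntegral.integral_const_mul]
  exact intervalIntegral.integral_mono_on huv hf
    ((intervalIntegrable_of_id_mul hu huv hf).const_mul v)
    fun x hx => mul_le_mul_of_nonneg_right hx.2 (hnonneg x)

variable {b : Fin 4 → ℝ}

theorem omegaDensity_one (b : Fin 4 → ℝ) :
    omegaDensity b 1 = fun x => x * omegaDensity b 0 x := by
  funext x
  rw [omegaDensity, omegaDensity, Fin.val_one, Fin.val_zero, pow_one, pow_zero, mul_one_div]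

theorem omegaDensity_zero_nonneg (b : Fin 4 → ℝ) (x : ℝ) : 0 ≤ omegaDensity b 0 x := by
  rw [omegaDensity, Fin.val_zero, pow_zero]
  positivity

theorem omegaDensity_one_pos (hb : StrictMono b) (hb0 : 0 < b 0) {x : ℝ}
    (hx : x ∈ Ioo (b 0) (b 1)) : 0 < omegaDensity b 1 x := by
  have hx0 : 0 < x := hb0.trans hx.1
  have h02 : 0 < b 2 - x := sub_pos.2 (hx.2.trans (hb (by decide)))
  have h03 : 0 < b 3 - x := sub_pos.2 (hx.2.trans (hb (by decide)))
  refine div_pos (pow_pos hx0 _) (Real.sqrt_pos.2 ?_)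
  rw [Fin.prod_univ_four]
  have := mul_pos (mul_pos (mul_pos (mul_pos hx0 (sub_pos.2 hx.1)) (sub_pos.2 hx.2)) h02) h03
  linarith

theorem alphaPeriod_zero_one_pos (hb : StrictMono b) (hb0 : 0 < b 0)
    (h : IntervalIntegrable (omegaDensity b 1) volume (b 0) (b 1)) : 0 < alphaPeriod b 0 1 :=
  mul_pos two_pos (intervalIntegral.intervalIntegral_pos_of_pos_on h
    (fun _ => omegaDensity_one_pos hb hb0) (hb (by decide)))

theorem alphaPeriod_zero_one_le (hb0 : 0 < b 0) (h01 : b 0 ≤ b 1)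
    (h : IntervalIntegrable (omegaDensity b 1) volume (b 0) (b 1)) :
    alphaPeriod b 0 1 ≤ b 1 * alphaPeriod b 0 0 := by
  have hle := integral_id_mul_le_mul_integral hb0 h01 (omegaDensity_zero_nonneg b)
    (omegaDensity_one b ▸ h)
  rw [← omegaDensity_one] at hle
  exact (mul_le_mul_of_nonneg_left hle two_pos.le).trans_eq (mul_left_comm _ _ _)

theorem mul_alphaPeriod_one_zero_le (hb2 : 0 < b 2) (h23 : b 2 ≤ b 3)
    (h : IntervalIntegrable (omegaDensity b 1) volume (b 2) (b 3)) :
    b 2 * alphaPeriod b 1 0 ≤ alphaPeriod b 1 1 := by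
  have hle := mul_integral_le_integral_id_mul hb2 h23 (omegaDensity_zero_nonneg b)
    (omegaDensity_one b ▸ h)
  rw [← omegaDensity_one] at hle
  exact (mul_left_comm _ _ _).trans_le (mul_le_mul_of_nonneg_left hle two_pos.le)

end PeriodComparison

section AngularBranchPoints

open Real

theorem exists_angle_of_quadratic {v₁ v₂ v₃ : ℝ} (h12 : v₁ < v₂) (h23 : v₂ < v₃)
    (q12 : v₁ ^ 2 + v₁ * v₂ + v₂ ^ 2 = 3 / 4) (q13 : v₁ ^ 2 + v₁ * v₃ + v₃ ^ 2 = 3 / 4)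
    (q23 : v₂ ^ 2 + v₂ * v₃ + v₃ ^ 2 = 3 / 4) :
    ∃ a, 0 < a ∧ a < π / 3 ∧ v₃ = cos a ∧ v₂ = cos (2 * π / 3 - a) ∧
      v₁ = cos (2 * π / 3 + a) := by
  have hsum : v₁ + v₂ + v₃ = 0 := add_add_eq_zero_of_quadratic h23.ne q12 q13
  have hsq : v₃ ^ 2 < 1 :=
    sq_lt_of_quadratic (v := v₁) (w := v₂) h12.ne (by linarith) (by linarith)
  obtain ⟨hlt, hgt⟩ := abs_lt.1 ((sq_lt_one_iff_abs_lt_one v₃).1 hsq)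
  have hcos : cos (arccos v₃) = v₃ := cos_arccos hlt.le hgt.le
  have hsin : v₂ + v₃ / 2 = √3 / 2 * sin (arccos v₃) := by
    refine (sq_eq_sq₀ (by linarith) (mul_nonneg (by positivity)
      (sin_arccos v₃ ▸ sqrt_nonneg _))).1 ?_
    rw [mul_pow, div_pow, sq_sqrt (by norm_num), sin_sq, hcos]
    linear_combination q23
  have hv₂ : v₂ = cos (2 * π / 3 - arccos v₃) := by
    rw [cos_sub, cos_two_pi_div_three, sin_two_pi_div_three, hcos]
    linarith
  have hv₁ : v₁ = cos (2 * π / 3 + arccos v₃) := by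
    rw [cos_add, cos_two_pi_div_three, sin_two_pi_div_three, hcos]
    linarith
  refine ⟨arccos v₃, arccos_pos.2 hgt, ?_, hcos.symm, hv₂, hv₁⟩
  by_contra! hle
  have habs : |2 * π / 3 - arccos v₃| ≤ arccos v₃ :=
    abs_le.2 ⟨by linarith [pi_pos], by linarith⟩
  have hcosle := cos_le_cos_of_nonneg_of_le_pi (abs_nonneg _) (arccos_le_pi v₃) habs
  rw [cos_abs, ← hv₂, hcos] at hcosle
  exact hcosle.not_gt h23

theorem CubicRelation.quadratic_div_sub_one {M x y : ℝ} (hM : M ≠ 0)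
    (h : CubicRelation 0 (2 * M) x y) :
    (x / M - 1) ^ 2 + (x / M - 1) * (y / M - 1) + (y / M - 1) ^ 2 = 3 / 4 := by
  rw [CubicRelation] at h
  field_simp
  linear_combination 4 * h

variable {b : Fin 4 → ℝ}

theorem strictMono_nodes (hb : StrictMono b) (hb0 : 0 < b 0) : StrictMono (nodes b) := by
  have hpos (k : Fin 4) : 0 < b k := hb0.trans_le (hb.monotone (Fin.zero_le k))
  refine strictMono_vecCons.2 ⟨inv_pos.2 (hpos _), fun i j hij => ?_⟩
  exact inv_strictAnti₀ (hpos _) (hb (Fin.rev_lt_rev.2 hij))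

theorem cubicRelation_nodes_of_tangentialCover (hb : StrictMono b) (hb0 : 0 < b 0)
    (h : IsHyperellipticTangentialCover b 3) {k l : Fin 5} (hkl : k ≠ l) (hk₀ : k ≠ 0)
    (hk₄ : k ≠ 4) (hl₀ : l ≠ 0) (hl₄ : l ≠ 4) :
    CubicRelation 0 (b 0)⁻¹ (nodes b k) (nodes b l) := by
  have hne (k : Fin 4) : b k ≠ 0 := (hb0.trans_le (hb.monotone (Fin.zero_le k))).ne'
  obtain ⟨ρ, σ, γ, c, hform⟩ := exists_invCurvePoly_eq_of_tangentialCover hb.injective hne h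
  exact cubicRelation_of_strictMono (strictMono_nodes hb hb0) (neg_prod_ne_zero hne) hform hkl
    hk₀ hk₄ hl₀ hl₄

theorem exists_eq_angleBranchPoints (hb : StrictMono b) (hb0 : 0 < b 0)
    (h : IsHyperellipticTangentialCover b 3) :
    ∃ M a, 0 < M ∧ 0 < a ∧ a < π / 3 ∧ b = angleBranchPoints M a := by
  obtain ⟨M, hM, hMb⟩ : ∃ M, 0 < M ∧ (b 0)⁻¹ = 2 * M := ⟨(b 0)⁻¹ / 2, by positivity, by ring⟩
  have hquad {k l : Fin 5} (hkl : k ≠ l) (hk₀ : k ≠ 0) (hk₄ : k ≠ 4) (hl₀ : l ≠ 0) (hl₄ : l ≠ 4) :=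
    (hMb ▸ cubicRelation_nodes_of_tangentialCover hb hb0 h hkl hk₀ hk₄ hl₀ hl₄
      ).quadratic_div_sub_one hM.ne'
  have hlt {i j : Fin 5} (hij : i < j) : nodes b i / M - 1 < nodes b j / M - 1 :=
    sub_lt_sub_right (div_lt_div_of_pos_right (strictMono_nodes hb hb0 hij) hM) 1
  obtain ⟨a, ha, ha', h₁, h₂, h₃⟩ := exists_angle_of_quadratic
    (hlt (i := 1) (j := 2) (by decide)) (hlt (j := 3) (by decide))
    (hquad (by decide) (by decide) (by decide) (by decide) (by decide))
    (hquad (by decide) (by decide) (by decide) (by decide) (by decide))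
    (hquad (by decide) (by decide) (by decide) (by decide) (by decide))
  refine ⟨M, a, hM, ha, ha', funext fun k => eq_angleCoord_of_inv_div_sub_one hM.ne' ?_⟩
  fin_cases k
  · change (b 0)⁻¹ / M - 1 = cos 0
    rw [hMb, mul_div_cancel_right₀ _ hM.ne', cos_zero]
    norm_num
  exacts [h₁, h₂, h₃]

theorem alphaPeriod_relations_of_tangentialCover (hb : StrictMono b) (hb0 : 0 < b 0)
    (h : IsHyperellipticTangentialCover b 3) :
    0 < alphaPeriod b 0 1 ∧ alphaPeriod b 1 1 = 2 * alphaPeriod b 0 1 ∧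
      alphaPeriod b 1 0 < 2 * alphaPeriod b 0 0 := by
  obtain ⟨M, a, hM, ha, ha', rfl⟩ := exists_eq_angleBranchPoints hb hb0 h
  set b := angleBranchPoints M a
  have hleft := intervalIntegrable_omegaDensity_left hM ha ha'
  have h01 : b 0 < b 1 := hb (by decide)
  have h12 : b 1 < b 2 := hb (by decide)
  have hb2 : 0 < b 2 := (hb0.trans h01).trans h12
  have hpos : 0 < alphaPeriod b 0 1 := alphaPeriod_zero_one_pos hb hb0 hleft
  have hratio : alphaPeriod b 1 1 = 2 * alphaPeriod b 0 1 :=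
    alphaPeriod_one_one_angleBranchPoints hM ha ha'
  have hle := alphaPeriod_zero_one_le hb0 h01.le hleft
  have hpos' : 0 < alphaPeriod b 0 0 :=
    pos_of_mul_pos_right (hpos.trans_le hle) (hb0.trans h01).le
  refine ⟨hpos, hratio, lt_of_mul_lt_mul_left ?_ hb2.le⟩
  calc b 2 * alphaPeriod b 1 0
      ≤ alphaPeriod b 1 1 := mul_alphaPeriod_one_zero_le hb2 (hb (by decide)).le
        (intervalIntegrable_omegaDensity_right hM ha ha')
    _ = 2 * alphaPeriod b 0 1 := hratio
    _ ≤ 2 * (b 1 * alphaPeriod b 0 0) := mul_le_mul_of_nonneg_left hle two_pos.le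
    _ < 2 * (b 2 * alphaPeriod b 0 0) := by gcongr
    _ = b 2 * (2 * alphaPeriod b 0 0) := mul_left_comm _ _ _

end AngularBranchPoints

theorem isHill_of_alphaPeriod_eq {b : Fin 4 → ℝ}
    (hratio : alphaPeriod b 1 1 = 2 * alphaPeriod b 0 1)
    (hlt : alphaPeriod b 1 0 < 2 * alphaPeriod b 0 0) : IsHill b := by
  refine ⟨![2, -1], fun h => two_ne_zero (congrFun h 0), 2 * alphaPeriod b 0 0 - alphaPeriod b 1 0,
    sub_pos.2 hlt, ?_, ?_⟩
  all_goals simp only [Fin.sum_univ_two, Matrix.cons_val_zero, Matrix.cons_val_one, Int.cast_neg,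
    Int.cast_ofNat, Int.cast_one, hratio]
  all_goals ring

theorem strictMono_branchPoints {a₁ a₂ a₃ c : ℝ} (h₁₂ : a₁ < a₂) (h₂₃ : a₂ < a₃)
    (hc₁ : a₁ < c) (hc₃ : c < a₃) (hc₂ : c ≠ a₂) : StrictMono (branchPoints a₁ a₂ a₃ c) := by
  rw [Fin.strictMono_iff_lt_succ, branchPoints]
  intro i
  split_ifs with hc
  · fin_cases i <;> assumption
  · have hc' : a₂ < c := hc₂.symm.lt_of_le (not_lt.1 hc)
    fin_cases i <;> assumption

theorem branchPoints_zero (a₁ a₂ a₃ c : ℝ) : branchPoints a₁ a₂ a₃ c 0 = a₁ := by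
  rw [branchPoints]
  split_ifs <;> rfl

end GeodesicCurve

theorem mainTheorem10 (a₁ a₂ a₃ c : ℝ) (h₀ : 0 < a₁) (h₁₂ : a₁ < a₂) (h₂₃ : a₂ < a₃)
    (hc₁ : a₁ < c) (hc₃ : c < a₃) (hc₂ : c ≠ a₂)
    (hΓ : GeodesicCurve.IsHyperellipticTangentialCover
      (GeodesicCurve.branchPoints a₁ a₂ a₃ c) 3) :
    GeodesicCurve.IsHill (GeodesicCurve.branchPoints a₁ a₂ a₃ c) ∧
      (c < a₂ → GeodesicCurve.periodMapping a₁ a₂ a₃ c = 2) ∧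
      (a₂ < c → GeodesicCurve.periodMapping a₁ a₂ a₃ c = 1 / 2) := by
  obtain ⟨hpos, hratio, hlt⟩ := GeodesicCurve.alphaPeriod_relations_of_tangentialCover
    (GeodesicCurve.strictMono_branchPoints h₁₂ h₂₃ hc₁ hc₃ hc₂)
    ((GeodesicCurve.branchPoints_zero a₁ a₂ a₃ c).symm ▸ h₀) hΓ
  refine ⟨GeodesicCurve.isHill_of_alphaPeriod_eq hratio hlt, fun hc => ?_, fun hc => ?_⟩
  · rw [GeodesicCurve.periodMapping, if_pos hc, hratio]
    field_simp
  · rw [GeodesicCurve.periodMapping, if_neg hc.not_gt, hratio]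
    field_simp
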